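/- Let $G$ be a compact connected semisimple Lie group and $L\subsetneq K\subsetneq G$ connected closed non-trivial subgroups, with Lie algebras $\mathfrak l\subset\mathfrak k\subset\mathfrak g$. Let $\Phi$ be the Killing form of $\mathfrak g$, $B=-\Phi$, and let $\mathfrak g=\mathfrak k\oplus\mathfrak n$, $\mathfrak k=\mathfrak l\oplus\mathfrak p$, $\mathfrak m=\mathfrak p\oplus\mathfrak n$ be the $B$-orthogonal decompositions, so that $\mathfrak m,\mathfrak n,\mathfrak p$ are the tangent spaces at the origin of $M=G/L$, $N=G/K$, $F=K/L$. Assume that $N$ is isotropy irreducible ($\mathfrak n$ is $\mathrm{Ad}\,K$-irreducible), that $F$ is symmetric ($[\mathfrak p,\mathfrak p]\subset\mathfrak l$), that $\mathfrak p=\mathfrak p_1\oplus\mathfrak p_2$ with inequivalent irreducible $\mathrm{Ad}\,L$-submodules, neither of them central in $\mathfrak k$ (no Euclidean factor; this is automatic when $F$ is simply connected), and that $\mathfrak p$ and $\mathfrak n$ contain no equivalent non-zero $\mathrm{Ad}\,L$-submodules. For a subspace $U\subset\mathfrak g$ put $C_U=-\sum_i(\mathrm{ad}_{e_i})^2$,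 where $(e_i)$ is a $B$-orthonormal basis of $U$. Let $\gamma_a$ be the eigenvalue of $C_{\mathfrak k}$ on $\mathfrak p_a$ and $c=c_{\mathfrak k,\mathfrak n}$ its eigenvalue on $\mathfrak n$. Assume that $C_{\mathfrak p_a}|_{\mathfrak n}=b_a\,\mathrm{Id}$ for constants $b_a$, $a=1,2$, and let $b$ be the eigenvalue of $C_{\mathfrak p}$ on $\mathfrak n$ (so $b=b_1+b_2$). Call a $G$-invariant Riemannian metric on $M$ adapted if, for some $G$-invariant metric on $N$, the projection $M\to N$ is a Riemannian submersion with totally geodesic fibers. Invariant metrics on $M$ are identified with $\mathrm{Ad}\,L$-invariant Euclidean products on $\mathfrak m$. Let $g_M$ be an Einstein adapted metric on $M$ whose restriction $g_F$ to $F$ is also Einstein. Then $\gamma_2=\gamma_1$ or $\gamma_2=1-\gamma_1$, and: (i) If $\gamma_2=\gamma_1$, then $\triangle\ge 0$, where $$\triangle=(1+2c)^2-8\gamma_1(1-\gamma_1+2b),$$ and $g_M$ is, up to homothety, the binormal metric given by $$B_{\mathfrak p}\oplus X\,B_{\mathfrak n},\qquad X=\frac{1+2c\pm\sqrt{\triangle}}{4\gamma_1}>0,$$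 for one of the two signs. (ii) If $\gamma_2=1-\gamma_1$, then $D(\gamma_1)\ge0$, where $$D(\gamma_1)=4r^2-4b_1\gamma_1-4b_2(1-\gamma_1)-2\gamma_1(1-\gamma_1),\qquad r=\tfrac12\left(\tfrac12+c\right),$$ and $g_M$ is, up to homothety, given by $$\frac1{X_1}B_{\mathfrak p_1}\oplus\frac1{X_2}B_{\mathfrak p_2}\oplus B_{\mathfrak n},\qquad X_1=\frac{2r\pm\sqrt{D(\gamma_1)}}{2\gamma_1}>0,\qquad X_2=\frac{\gamma_1X_1}{1-\gamma_1}>0,$$ for one of the two signs. -/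

import Mathlib

open scoped Manifold ContDiff

noncomputable section

/-! ### Lie algebra level: Killing form, Casimir operators, invariant metrics and their curvature

Throughout `𝔤` is a finite-dimensional real Lie algebra and `Φ = killingForm ℝ 𝔤`. -/

namespace HomFib

section Algebraic

variable {𝔤 : Type*} [LieRing 𝔤] [LieAlgebra ℝ 𝔤]

/-- The orthogonal complement `U^⊥ ⊆ 𝔤` of a subspace with respect to the Killing form `Φ`
(equivalently, with respect to `B = -Φ`). -/
def perp (U : Submodule ℝ 𝔤) : Submodule ℝ 𝔤 :=
  LinearMap.BilinForm.orthogonal (killingForm ℝ 𝔤) U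

open Classical in
/-- The `Φ`-orthogonal projection `𝔤 → U`. If `Φ` is negative definite, then `𝔤 = U ⊕ U^⊥` always
holds and the default value `0` is never used. -/
def orthProj (U : Submodule ℝ 𝔤) : 𝔤 →ₗ[ℝ] U :=
  if h : IsCompl U (perp U) then Submodule.projectionOnto U (perp U) h else 0

/-- The form `-Φ`, written `B`; it is an inner product on `𝔤` when `𝔤` is compact semisimple. -/
def B (x y : 𝔤) : ℝ := -killingForm ℝ 𝔤 x y

/-- The Gram matrix of `Φ` on a subspace, in a chosen basis of the subspace. -/
def gram [FiniteDimensional ℝ 𝔤] (U : Submodule ℝ 𝔤) :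
    Matrix (Fin (Module.finrank ℝ U)) (Fin (Module.finrank ℝ U)) ℝ :=
  Matrix.of fun i j =>
    killingForm ℝ 𝔤 (Module.finBasis ℝ U i : 𝔤) (Module.finBasis ℝ U j : 𝔤)

/-- The Casimir operator `C_U` of a subspace `U` with respect to the Killing form `Φ`, in a form
that does not need a `Φ`-orthonormal basis: `C_U = ∑ (Φ⁻¹)^{ij} ad_{b_i} ad_{b_j}` for a basis
`b` of `U`. If `Φ` is negative definite it equals `-∑ (ad_{e_i})^2` for every basis `e` of `U`
that is orthonormal for `B = -Φ` (see `casimir_eq`), i.e. it is `∑ (ad_{u_i})^2` for the basis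
`u_i = √-1 e_i`, which is orthonormal for (the complexification of) `Φ`. -/
def casimir [FiniteDimensional ℝ 𝔤] (U : Submodule ℝ 𝔤) : Module.End ℝ 𝔤 :=
  ∑ i, ∑ j, (gram U)⁻¹ i j •
    (LieAlgebra.ad ℝ 𝔤 (Module.finBasis ℝ U i : 𝔤) * LieAlgebra.ad ℝ 𝔤 (Module.finBasis ℝ U j : 𝔤))

theorem casimir_eq [FiniteDimensional ℝ 𝔤] (U : Submodule ℝ 𝔤)
    (e : Module.Basis (Fin (Module.finrank ℝ U)) ℝ U)
    (he : ∀ i j, B (e i : 𝔤) (e j : 𝔤) = if i = j then 1 else 0) :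
    casimir U = -∑ i, LieAlgebra.ad ℝ 𝔤 (e i : 𝔤) * LieAlgebra.ad ℝ 𝔤 (e i : 𝔤) := by
  set b := Module.finBasis ℝ U with hb
  set P : Matrix (Fin (Module.finrank ℝ U)) (Fin (Module.finrank ℝ U)) ℝ := b.toMatrix e with hP
  set Q : Matrix (Fin (Module.finrank ℝ U)) (Fin (Module.finrank ℝ U)) ℝ := e.toMatrix b with hQ
  have hPQ : P * Q = 1 := b.toMatrix_mul_toMatrix_flip e
  have hQP : Q * P = 1 := e.toMatrix_mul_toMatrix_flip b
  have hbe : ∀ i, (b i : 𝔤) = ∑ k, Q k i • (e k : 𝔤) := by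
    intro i
    rw [← e.sum_toMatrix_smul_self (fun j => b j) i, Submodule.coe_sum]
    simp only [Submodule.coe_smul]
    rfl
  have hM : gram U = -(Q.transpose * Q) := by
    ext i j
    have hk : ∀ k l, killingForm ℝ 𝔤 (e k : 𝔤) (e l : 𝔤) = if k = l then -1 else 0 := by
      intro k l
      have := he k l
      unfold B at this
      split_ifs at this ⊢ <;> linarith
    simp only [gram, Matrix.of_apply, ← hb, hbe, map_sum, map_smul, LinearMap.sum_apply,
      LinearMap.smul_apply, hk, Matrix.neg_apply, Matrix.mul_apply, Matrix.transpose_apply,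
      smul_eq_mul]
    simp [mul_comm]
  have hinv : (gram U)⁻¹ = -(P * P.transpose) := by
    apply Matrix.inv_eq_right_inv
    rw [hM, neg_mul_neg]
    calc Q.transpose * Q * (P * P.transpose)
        = Q.transpose * (Q * P) * P.transpose := by simp only [Matrix.mul_assoc]
      _ = (P * Q).transpose := by rw [hQP, Matrix.mul_one, Matrix.transpose_mul]
      _ = 1 := by rw [hPQ, Matrix.transpose_one]
  have heb : ∀ k, (e k : 𝔤) = ∑ i, P i k • (b i : 𝔤) := by
    intro k
    rw [← b.sum_toMatrix_smul_self (fun j => e j) k, Submodule.coe_sum]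
    simp only [Submodule.coe_smul]
    rfl
  have hrhs : ∀ k, LieAlgebra.ad ℝ 𝔤 (e k : 𝔤) * LieAlgebra.ad ℝ 𝔤 (e k : 𝔤)
      = ∑ i, ∑ j, (P i k * P j k) •
        (LieAlgebra.ad ℝ 𝔤 (b i : 𝔤) * LieAlgebra.ad ℝ 𝔤 (b j : 𝔤)) := by
    intro k
    rw [heb k]
    simp only [map_sum, map_smul, Finset.sum_mul_sum, smul_mul_smul_comm]
  unfold casimir
  rw [hinv, ← hb]
  simp only [hrhs]
  rw [Finset.sum_comm, ← Finset.sum_neg_distrib, Finset.sum_comm]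
  simp only [Matrix.neg_apply, Matrix.mul_apply, Matrix.transpose_apply, neg_smul, Finset.sum_smul,
    Finset.sum_neg_distrib]
  rw [neg_inj, Finset.sum_comm]
  rw [Finset.sum_comm (s := Finset.univ) (t := Finset.univ)
    (f := fun k i => ∑ j, (P i k * P j k) •
        (LieAlgebra.ad ℝ 𝔤 (b i : 𝔤) * LieAlgebra.ad ℝ 𝔤 (b j : 𝔤)))]
  rw [Finset.sum_comm]
  refine Finset.sum_congr rfl fun i _ => ?_
  rw [Finset.sum_comm]

/-! Let `𝔮` be the `Φ`-orthogonal reductive complement of the isotropy algebra of a homogeneous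
space, identified with its tangent space at the origin `o`. An invariant metric is an inner product
on `𝔮`. An invariant affine connection is a bilinear map `Λ : 𝔮 × 𝔮 → 𝔮`, its difference with the
canonical connection. -/

/-- `Λ` is the Levi-Civita connection of the invariant metric given by the inner product `g` on the
reductive complement `𝔮`: it is metric, `g(Λ(X)Y,Z) + g(Y,Λ(X)Z) = 0`, and it is torsion-free,
`Λ(X)Y - Λ(Y)X = [X,Y]_𝔮`. -/
def IsLeviCivita {𝔮 : Submodule ℝ 𝔤} (g : LinearMap.BilinForm ℝ 𝔮) (Λ : 𝔮 →ₗ[ℝ] 𝔮 →ₗ[ℝ] 𝔮) :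
    Prop :=
  (∀ X Y Z : 𝔮, g (Λ X Y) Z + g Y (Λ X Z) = 0) ∧
    ∀ X Y : 𝔮, Λ X Y - Λ Y X = orthProj 𝔮 ⁅(X : 𝔤), (Y : 𝔤)⁆

/-- The curvature tensor at the origin of the invariant connection `Λ`, as a linear function of `X`:
`R(X,Y)Z = Λ(X)Λ(Y)Z - Λ(Y)Λ(X)Z - Λ([X,Y]_𝔮)Z - [[X,Y]_𝔥,Z]`, where `𝔥` is the isotropy algebra;
here `[X,Y]_𝔥 = [X,Y] - [X,Y]_𝔮`, and the last bracket lies in `𝔮`. -/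
def curvature {𝔮 : Submodule ℝ 𝔤} (Λ : 𝔮 →ₗ[ℝ] 𝔮 →ₗ[ℝ] 𝔮) (Y Z : 𝔮) : 𝔮 →ₗ[ℝ] 𝔮 where
  toFun X :=
    Λ X (Λ Y Z) - Λ Y (Λ X Z) - Λ (orthProj 𝔮 ⁅(X : 𝔤), (Y : 𝔤)⁆) Z
      - orthProj 𝔮 ⁅⁅(X : 𝔤), (Y : 𝔤)⁆ - (orthProj 𝔮 ⁅(X : 𝔤), (Y : 𝔤)⁆ : 𝔤), (Z : 𝔤)⁆
  map_add' X X' := by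
    simp only [Submodule.coe_add, add_lie, map_add, LinearMap.add_apply, sub_lie, map_sub]
    abel
  map_smul' c X := by
    simp only [Submodule.coe_smul, smul_lie, map_smul, LinearMap.smul_apply, sub_lie, map_sub,
      RingHom.id_apply, smul_sub]

/-- The Ricci tensor `Ric(Y,Z) = tr (X ↦ R(X,Y)Z)` at the origin. -/
def ricci {𝔮 : Submodule ℝ 𝔤} (Λ : 𝔮 →ₗ[ℝ] 𝔮 →ₗ[ℝ] 𝔮) (Y Z : 𝔮) : ℝ :=
  LinearMap.trace ℝ 𝔮 (curvature Λ Y Z)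

/-- The invariant metric given by `g` is Einstein: `Ric = E g` for a constant `E`, where `Ric` is the
Ricci tensor of its (unique) Levi-Civita connection. -/
def IsEinstein {𝔮 : Submodule ℝ 𝔤} (g : LinearMap.BilinForm ℝ 𝔮) : Prop :=
  ∃ Λ : 𝔮 →ₗ[ℝ] 𝔮 →ₗ[ℝ] 𝔮, IsLeviCivita g Λ ∧ ∃ E : ℝ, ∀ Y Z : 𝔮, ricci Λ Y Z = E * g Y Z

end Algebraic

/-! ### Lie group level -/

section Group

variable {E : Type*} [NormedAddCommGroup E] [NormedSpace ℝ E]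
variable {G : Type*} [TopologicalSpace G] [ChartedSpace E G] [Group G]

instance completeSpace_of_finiteDimensional [FiniteDimensional ℝ E] : CompleteSpace E :=
  FiniteDimensional.complete ℝ E

/-- A smooth Lie group has the (finite) order of smoothness that Mathlib needs for its Lie algebra. -/
instance lieGroup_minSmoothness [LieGroup 𝓘(ℝ, E) ∞ G] :
    LieGroup 𝓘(ℝ, E) (minSmoothness ℝ 3) G :=
  LieGroup.of_le (n := ∞) (by simp only [minSmoothness_of_isRCLikeNormedField]; exact ENat.LEInfty.out)

/-- The Lie algebra of a Lie group `G` modelled on `E`: Mathlib's tangent space at `1` with the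
bracket of left-invariant vector fields. -/
def LieAlg (E : Type*) [NormedAddCommGroup E] [NormedSpace ℝ E]
    (G : Type*) [TopologicalSpace G] [ChartedSpace E G] [Group G] : Type _ :=
  GroupLieAlgebra 𝓘(ℝ, E) G

variable [FiniteDimensional ℝ E] [LieGroup 𝓘(ℝ, E) ∞ G]

instance : LieRing (LieAlg E G) := inferInstanceAs (LieRing (GroupLieAlgebra 𝓘(ℝ, E) G))

instance : LieAlgebra ℝ (LieAlg E G) := inferInstanceAs (LieAlgebra ℝ (GroupLieAlgebra 𝓘(ℝ, E) G))

instance : FiniteDimensional ℝ (LieAlg E G) := inferInstanceAs (FiniteDimensional ℝ E)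

/-- `Ad a`: the derivative at `1` of the conjugation `x ↦ a x a⁻¹`. (The tangent spaces at
`a 1 a⁻¹` and at `1` are the same, since these points are equal.) -/
def Ad (a : G) : LieAlg E G →ₗ[ℝ] LieAlg E G :=
  (mfderiv 𝓘(ℝ, E) 𝓘(ℝ, E) (fun x : G => a * x * a⁻¹) 1 :
    GroupLieAlgebra 𝓘(ℝ, E) G →L[ℝ] GroupLieAlgebra 𝓘(ℝ, E) G).toLinearMap

/-- The velocity at time `0` of a curve in `G`. It is only used for curves with `γ 0 = 1`, and is then
a tangent vector at `1`. -/
def velocity (γ : ℝ → G) : LieAlg E G := mfderiv 𝓘(ℝ, ℝ) 𝓘(ℝ, E) γ 0 (1 : ℝ)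

/-- The Lie algebra of a closed subgroup `K` of `G`: the tangent vectors at `1` of the smooth curves
in `G` that lie in `K`. (They already form a subspace; the span spares a proof of this.) -/
def lieSub (K : Subgroup G) : Submodule ℝ (LieAlg E G) :=
  Submodule.span ℝ {v | ∃ γ : ℝ → G, ContMDiff 𝓘(ℝ, ℝ) 𝓘(ℝ, E) ∞ γ ∧ γ 0 = 1 ∧ (∀ t, γ t ∈ K) ∧
    velocity γ = v}

/-- `U` is an `Ad H`-submodule. -/
def AdInvariant (H : Subgroup G) (U : Submodule ℝ (LieAlg E G)) : Prop :=
  ∀ a ∈ H, ∀ u ∈ U, Ad a u ∈ U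

/-- `U` is an irreducible `Ad H`-submodule. -/
def AdIrreducible (H : Subgroup G) (U : Submodule ℝ (LieAlg E G)) : Prop :=
  AdInvariant H U ∧ U ≠ ⊥ ∧ ∀ W ≤ U, AdInvariant H W → W = ⊥ ∨ W = U

/-- The `Ad H`-submodules `U` and `V` are equivalent. -/
def AdEquivalent (H : Subgroup G) (U V : Submodule ℝ (LieAlg E G)) : Prop :=
  ∃ e : U ≃ₗ[ℝ] V, ∀ a ∈ H, ∀ u u' : U,
    Ad a (u : LieAlg E G) = u' → Ad a (e u : LieAlg E G) = e u'

/-- `g` is an `Ad H`-invariant Euclidean product on `𝔮`. -/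
def IsInvariantMetric (H : Subgroup G) {𝔮 : Submodule ℝ (LieAlg E G)}
    (g : LinearMap.BilinForm ℝ 𝔮) : Prop :=
  (∀ v w, g v w = g w v) ∧ (∀ v, v ≠ 0 → 0 < g v v) ∧
    ∀ a ∈ H, ∀ v w v' w' : 𝔮, Ad a (v : LieAlg E G) = v' → Ad a (w : LieAlg E G) = w' →
      g v' w' = g v w

/-- The reductive complement `𝔪` of `𝔩` in `𝔤`, the tangent space of `M = G/L` at the origin. -/
def mSpace (L : Subgroup G) : Submodule ℝ (LieAlg E G) := perp (lieSub L)

/-- The reductive complement `𝔫` of `𝔨` in `𝔤`, the tangent space of `N = G/K` at the origin. -/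
def nSpace (K : Subgroup G) : Submodule ℝ (LieAlg E G) := perp (lieSub K)

/-- The reductive complement `𝔭` of `𝔩` in `𝔨`, the tangent space of `F = K/L` at the origin. -/
def pSpace (K L : Subgroup G) : Submodule ℝ (LieAlg E G) := lieSub K ⊓ mSpace L

/-- The homogeneous fibration `G/L → G/K` of a (compact connected semisimple) Lie group `G`, with
isotropy irreducible base, with symmetric fiber `K/L` without Euclidean factor, and with
`𝔭 = 𝔭₁ ⊕ 𝔭₂`. -/
structure IsSymmetricFibration (K L : Subgroup G) (p₁ p₂ : Submodule ℝ (LieAlg E G)) : Prop where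
  closed_L : IsClosed (L : Set G)
  closed_K : IsClosed (K : Set G)
  connected_L : IsConnected (L : Set G)
  connected_K : IsConnected (K : Set G)
  nontrivial_L : L ≠ ⊥
  L_lt_K : L < K
  K_lt_G : K < ⊤
  /-- `N = G/K` is isotropy irreducible. -/
  base_irreducible : AdIrreducible (E := E) K (nSpace K)
  /-- `F = K/L` is a symmetric space, `𝔨 = 𝔩 ⊕ 𝔭` being a symmetric decomposition. -/
  fiber_symmetric : ∀ X ∈ pSpace (E := E) K L, ∀ Y ∈ pSpace (E := E) K L, ⁅X, Y⁆ ∈ lieSub (E := E) L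
  /-- `𝔭 = 𝔭₁ ⊕ 𝔭₂` with irreducible `Ad L`-submodules. -/
  sup_eq : p₁ ⊔ p₂ = pSpace K L
  disjoint : Disjoint p₁ p₂
  irreducible₁ : AdIrreducible L p₁
  irreducible₂ : AdIrreducible L p₂
  /-- `F` has no Euclidean factor: no `𝔭ₐ` is central in `𝔨`. This is automatic when `F` is simply
  connected. -/
  no_flat₁ : ∃ X ∈ lieSub (E := E) K, ∃ Y ∈ p₁, ⁅X, Y⁆ ≠ 0
  no_flat₂ : ∃ X ∈ lieSub (E := E) K, ∃ Y ∈ p₂, ⁅X, Y⁆ ≠ 0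
  /-- `𝔭₁` and `𝔭₂` are inequivalent. -/
  inequivalent : ¬ AdEquivalent L p₁ p₂
  /-- `𝔭` and `𝔫` do not contain equivalent (non-zero) `Ad L`-submodules. -/
  inequivalent_base : ∀ U V : Submodule ℝ (LieAlg E G), U ≤ pSpace K L → V ≤ nSpace K →
    AdInvariant L U → AdInvariant L V → U ≠ ⊥ → ¬ AdEquivalent L U V

/-- The restriction `g_F` to the fiber `F = K/L` of the metric `g` on `M = G/L`. -/
def fiberMetric (K : Subgroup G) {L : Subgroup G}
    (g : LinearMap.BilinForm ℝ (mSpace (E := E) L)) :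
    LinearMap.BilinForm ℝ (pSpace (E := E) K L) :=
  g.compl₁₂ (Submodule.inclusion inf_le_right) (Submodule.inclusion inf_le_right)

/-- The `G`-invariant metric on `M = G/L` given by the Euclidean product `g` on `𝔪` is an adapted
metric: for some `G`-invariant metric `gN` on `N = G/K`, the projection `M → N` is a Riemannian
submersion with totally geodesic fibers. By homogeneity this is a condition at the origin, where
the differential of `M → N` is the projection `𝔪 = 𝔭 ⊕ 𝔫 → 𝔫`, the vertical space is `𝔭`, the
horizontal space is its `g`-orthogonal complement, and the second fundamental form of the fiber is
the horizontal part of `Λ(X)Y` for `X, Y ∈ 𝔭`. -/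
def IsAdapted (K : Subgroup G) {L : Subgroup G}
    (g : LinearMap.BilinForm ℝ (mSpace (E := E) L)) : Prop :=
  IsInvariantMetric L g ∧
  (∃ gN : LinearMap.BilinForm ℝ (nSpace (E := E) K), IsInvariantMetric K gN ∧
    ∀ v w : mSpace (E := E) L,
      (∀ x : mSpace (E := E) L, (x : LieAlg E G) ∈ pSpace (E := E) K L → g x v = 0 ∧ g x w = 0) →
      g v w = gN (orthProj (nSpace K) (v : LieAlg E G)) (orthProj (nSpace K) (w : LieAlg E G))) ∧
  ∃ Λ, IsLeviCivita g Λ ∧ ∀ X Y : mSpace (E := E) L, (X : LieAlg E G) ∈ pSpace (E := E) K L →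
    (Y : LieAlg E G) ∈ pSpace (E := E) K L → (Λ X Y : LieAlg E G) ∈ pSpace (E := E) K L

/-- `B_U`: the form `B` on the `U`-components. -/
def BPart (U : Submodule ℝ (LieAlg E G)) (v w : LieAlg E G) : ℝ :=
  B (orthProj U v : LieAlg E G) (orthProj U w : LieAlg E G)

/-- Up to homothety, the metric `g` on `M = G/L` is the binormal metric `B_𝔭 ⊕ X B_𝔫`. -/
def IsBinormalUpToHomothety (K : Subgroup G) {L : Subgroup G}
    (g : LinearMap.BilinForm ℝ (mSpace (E := E) L)) (X : ℝ) : Prop :=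
  ∃ t : ℝ, 0 < t ∧ ∀ v w : mSpace (E := E) L,
    g v w = t * (BPart (pSpace K L) (v : LieAlg E G) w + X * BPart (nSpace K) (v : LieAlg E G) w)

/-- Up to homothety, the metric `g` on `M = G/L` is `(1/X₁) B_𝔭₁ ⊕ (1/X₂) B_𝔭₂ ⊕ B_𝔫`. -/
def IsDiagonalUpToHomothety (K : Subgroup G) {L : Subgroup G} (p₁ p₂ : Submodule ℝ (LieAlg E G))
    (g : LinearMap.BilinForm ℝ (mSpace (E := E) L)) (X₁ X₂ : ℝ) : Prop :=
  ∃ t : ℝ, 0 < t ∧ ∀ v w : mSpace (E := E) L,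
    g v w = t * (1 / X₁ * BPart p₁ (v : LieAlg E G) w + 1 / X₂ * BPart p₂ (v : LieAlg E G) w
      + BPart (nSpace K) (v : LieAlg E G) w)

end Group

/-- The discriminant in the case `γ₂ = γ₁ = γ`; `b` is the eigenvalue of `C_𝔭` on `𝔫`. -/
def discΔ (γ b c : ℝ) : ℝ := (1 + 2 * c) ^ 2 - 8 * γ * (1 - γ + 2 * b)

/-- `r = (1/2)(1/2 + c)`. -/
def rConst (c : ℝ) : ℝ := 1 / 2 * (1 / 2 + c)

/-- The discriminant in the case `γ₂ = 1 - γ₁`, `γ = γ₁`. -/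
def discD (γ b₁ b₂ c : ℝ) : ℝ :=
  4 * rConst c ^ 2 - 4 * b₁ * γ - 4 * b₂ * (1 - γ) - 2 * γ * (1 - γ)

end HomFib

end

open scoped Topology

noncomputable section

/-! Schur's lemma makes an adapted metric diagonal, `g = x₁ B_𝔭₁ ⊕ x₂ B_𝔭₂ ⊕ y B_𝔫`
(`IsSymmetricFibration.isDiagMetric`): each `𝔭ₐ` is `Ad L`-irreducible, the submersion makes the
metric on `𝔫` invariant under `Ad K`, and the mixed terms vanish because the modules are
inequivalent. The problem then concerns three positive numbers.

The Koszul formula gives the Levi-Civita connection of a diagonal metric explicitly, and its Ricci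
tensor reduces to traces of `ad_Y²` over `𝔩`, `𝔭ₐ`, `𝔫`; these traces are determined by Casimir
eigenvalues. With `tₐ = xₐ/(2y)`, the quotient `Ric(Y,Y)/B(Y,Y)` is `γₐ/2 + tₐ²(1 - γₐ)` on `𝔭ₐ`
(`ricci_p₁`) and `1/4 + c/2 - t₁b₁ - t₂b₂` on `𝔫` (`ricci_n`). For the fiber alone it is `γₐ/2`,
whatever the metric (`ricci_fiber`).

The fiber is Einstein exactly when the `xₐ` are proportional to the `γₐ`, say `tₐ = λγₐ`. The
equation on `𝔭ₐ`, divided by `γₐ > 0`, becomes `1/2 + λ²γₐ(1 - γₐ) = 2λs` with the same `s` for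
both, so `γ₁(1 - γ₁) = γ₂(1 - γ₂)`; this is the dichotomy (`einstein_ratio`). Inserting `s` from the
equation on `𝔫` leaves a quadratic equation for `X = y/x₁ = 1/(2t₁)`. Having a real root, it has
non-negative discriminant, and `X` is one of the two roots.

The remaining work brings the hypotheses on the group down to the Lie algebra. In a chart at the
identity, the bracket and the derivative of `Ad` are the same antisymmetrized second derivative of
the multiplication (`hasDerivAt_Ad`). Hence `Ad`-invariant subspaces and forms are `ad`-invariant,
and averaging over the compact group shows that the Killing form is negative definite
(`killingForm_neg`). -/

namespace HomFib

/-! ### Multiplication, conjugation and `Ad` in the chart at the identity -/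

section LieGroup

variable {E : Type*} [NormedAddCommGroup E] [NormedSpace ℝ E]
variable {G : Type*} [TopologicalSpace G] [ChartedSpace E G] [Group G]

variable (E G) in
/-- The preferred chart of `G` at the identity. -/
def chartOne : PartialEquiv G E := extChartAt 𝓘(ℝ, E) (1 : G)

/-- The multiplication of `G`, read in the chart at the identity. -/
def localMul (G : Type*) [TopologicalSpace G] [ChartedSpace E G] [Group G] (p : E × E) : E :=
  chartOne E G ((chartOne E G).symm p.1 * (chartOne E G).symm p.2)

/-- The conjugation by `a`, read in the chart at the identity. -/
def localConj (a : G) (y : E) : E := chartOne E G (a * (chartOne E G).symm y * a⁻¹)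

variable (E G) in
/-- The point of the model space that corresponds to the identity. -/
def chartOrigin : E := chartOne E G 1

@[simp] theorem chartOne_symm_origin : (chartOne E G).symm (chartOrigin E G) = 1 :=
  extChartAt_to_inv (I := 𝓘(ℝ, E)) (1 : G)

@[simp] theorem chartOne_one : chartOne E G 1 = chartOrigin E G := rfl

theorem eventually_mem_source : ∀ᶠ x : G in 𝓝 1, x ∈ (chartOne E G).source :=
  extChartAt_source_mem_nhds (I := 𝓘(ℝ, E)) (1 : G)

theorem eventually_mem_target : ∀ᶠ y : E in 𝓝 (chartOrigin E G), y ∈ (chartOne E G).target := by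
  have := extChartAt_target_mem_nhds (I := 𝓘(ℝ, E)) (1 : G)
  exact this

theorem continuousAt_chartOne_symm : ContinuousAt (chartOne E G).symm (chartOrigin E G) :=
  continuousAt_extChartAt_symm (I := 𝓘(ℝ, E)) (1 : G)

theorem continuousAt_chartOne : ContinuousAt (chartOne E G) 1 :=
  continuousAt_extChartAt (I := 𝓘(ℝ, E)) (1 : G)

theorem localConj_origin (a : G) : localConj a (chartOrigin E G) = chartOrigin E G := by
  simp [localConj]

theorem contMDiffAt_chartOne : ContMDiffAt 𝓘(ℝ, E) 𝓘(ℝ, E) ∞ (chartOne E G) (1 : G) :=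
  contMDiffAt_extChartAt (I := 𝓘(ℝ, E))

variable [LieGroup 𝓘(ℝ, E) ∞ G]

theorem contMDiffAt_chartOne_symm :
    ContMDiffAt 𝓘(ℝ, E) 𝓘(ℝ, E) ∞ (chartOne E G).symm (chartOrigin E G) :=
  (contMDiffOn_extChartAt_symm (I := 𝓘(ℝ, E)) (n := ∞) (1 : G)).contMDiffAt eventually_mem_target

theorem contDiffAt_localMul :
    ContDiffAt ℝ ∞ (localMul (E := E) G) (chartOrigin E G, chartOrigin E G) := by
  rw [← contMDiffAt_iff_contDiffAt]
  have h1 : ContMDiffAt 𝓘(ℝ, E × E) 𝓘(ℝ, E) ∞ (fun p : E × E => (chartOne E G).symm p.1)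
      (chartOrigin E G, chartOrigin E G) :=
    ContMDiffAt.comp (I' := 𝓘(ℝ, E)) (chartOrigin E G, chartOrigin E G)
      contMDiffAt_chartOne_symm contDiff_fst.contMDiff.contMDiffAt
  have h2 : ContMDiffAt 𝓘(ℝ, E × E) 𝓘(ℝ, E) ∞ (fun p : E × E => (chartOne E G).symm p.2)
      (chartOrigin E G, chartOrigin E G) :=
    ContMDiffAt.comp (I' := 𝓘(ℝ, E)) (chartOrigin E G, chartOrigin E G)
      contMDiffAt_chartOne_symm contDiff_snd.contMDiff.contMDiffAt
  refine ContMDiffAt.comp_of_eq (contMDiffAt_chartOne (E := E) (G := G)) (h1.mul h2) ?_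
  simp

theorem contDiffAt_localConj_symm :
    ContDiffAt ℝ ∞ (fun p : E × E => localConj ((chartOne E G).symm p.1) p.2)
      (chartOrigin E G, chartOrigin E G) := by
  rw [← contMDiffAt_iff_contDiffAt]
  have h1 : ContMDiffAt 𝓘(ℝ, E × E) 𝓘(ℝ, E) ∞ (fun p : E × E => (chartOne E G).symm p.1)
      (chartOrigin E G, chartOrigin E G) :=
    ContMDiffAt.comp (I' := 𝓘(ℝ, E)) (chartOrigin E G, chartOrigin E G)
      contMDiffAt_chartOne_symm contDiff_fst.contMDiff.contMDiffAt
  have h2 : ContMDiffAt 𝓘(ℝ, E × E) 𝓘(ℝ, E) ∞ (fun p : E × E => (chartOne E G).symm p.2)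
      (chartOrigin E G, chartOrigin E G) :=
    ContMDiffAt.comp (I' := 𝓘(ℝ, E)) (chartOrigin E G, chartOrigin E G)
      contMDiffAt_chartOne_symm contDiff_snd.contMDiff.contMDiffAt
  refine ContMDiffAt.comp_of_eq (contMDiffAt_chartOne (E := E) (G := G)) ((h1.mul h2).mul h1.inv) ?_
  simp

theorem contMDiff_conj (a : G) : ContMDiff 𝓘(ℝ, E) 𝓘(ℝ, E) ∞ (fun x : G => a * x * a⁻¹) :=
  (contMDiff_const.mul contMDiff_id).mul contMDiff_const

theorem contDiffAt_localConj (a : G) : ContDiffAt ℝ ∞ (localConj (E := E) a) (chartOrigin E G) := by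
  rw [← contMDiffAt_iff_contDiffAt]
  refine ContMDiffAt.comp_of_eq (contMDiffAt_chartOne (E := E) (G := G))
    (ContMDiffAt.comp _ (contMDiff_conj (E := E) a).contMDiffAt contMDiffAt_chartOne_symm) ?_
  simp

theorem localConj_comp (a b : G) :
    localConj (E := E) (a * b) =ᶠ[𝓝 (chartOrigin E G)] localConj a ∘ localConj b := by
  have hc : ContinuousAt (fun y => b * (chartOne E G).symm y * b⁻¹) (chartOrigin E G) := by
    have := topologicalGroup_of_lieGroup 𝓘(ℝ, E) ∞ (G := G)
    exact (continuousAt_const.mul continuousAt_chartOne_symm).mul continuousAt_const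
  have := hc.tendsto.eventually (p := fun x => x ∈ (chartOne E G).source)
    (by simpa using eventually_mem_source)
  filter_upwards [this] with y hy
  simp only [localConj, Function.comp, (chartOne E G).left_inv hy]
  congr 1
  group

variable (E G) in
/-- `Ad`, read in the chart at the identity. -/
def localAd (z : E) : E →L[ℝ] E := fderiv ℝ (localConj ((chartOne E G).symm z)) (chartOrigin E G)

theorem contDiffAt_localAd : ContDiffAt ℝ ∞ (localAd E G) (chartOrigin E G) :=
  ContDiffAt.fderiv (f := fun z y => localConj ((chartOne E G).symm z) y)
    contDiffAt_localConj_symm contDiffAt_const (by simp)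

variable [FiniteDimensional ℝ E]

variable (E G) in
/-- The Lie algebra of `G` is the model space, as a vector space. -/
def toModel : LieAlg E G ≃ₗ[ℝ] E := LinearEquiv.refl ℝ E

theorem toModel_Ad (a : G) (v : LieAlg E G) :
    toModel E G (Ad a v) = fderiv ℝ (localConj a) (chartOrigin E G) (toModel E G v) := by
  have h : MDifferentiableAt 𝓘(ℝ, E) 𝓘(ℝ, E) (fun x : G => a * x * a⁻¹) 1 :=
    (contMDiff_conj (E := E) a).contMDiffAt.mdifferentiableAt (by simp)
  change (mfderiv 𝓘(ℝ, E) 𝓘(ℝ, E) (fun x : G => a * x * a⁻¹) 1 : E →L[ℝ] E) v = _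
  rw [h.mfderiv]
  have h1 : writtenInExtChartAt 𝓘(ℝ, E) 𝓘(ℝ, E) (1 : G) (fun x : G => a * x * a⁻¹) =
      localConj a := by
    funext y
    -- The target chart is the one at `a * 1 * a⁻¹`, which is `1` only propositionally.
    have : a * 1 * a⁻¹ = 1 := by simp
    simp only [writtenInExtChartAt, localConj, this, chartOne, Function.comp]
  rw [h1]
  simp only [modelWithCornersSelf_coe, Set.range_id, fderivWithin_univ]
  rfl

theorem Ad_mul (a b : G) (v : LieAlg E G) : Ad (a * b) v = Ad a (Ad b v) := by
  apply (toModel E G).injective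
  have ha := (contDiffAt_localConj (E := E) a).differentiableAt (by simp)
  have hb := (contDiffAt_localConj (E := E) b).differentiableAt (by simp)
  rw [toModel_Ad, toModel_Ad, toModel_Ad, (localConj_comp a b).fderiv_eq]
  rw [fderiv_comp _ (by rwa [localConj_origin]) hb, localConj_origin]
  rfl

theorem Ad_one (v : LieAlg E G) : Ad (1 : G) v = v := by
  apply (toModel E G).injective
  rw [toModel_Ad]
  have : localConj (1 : G) =ᶠ[𝓝 (chartOrigin E G)] id := by
    filter_upwards [eventually_mem_target] with y hy
    simp [localConj, (chartOne E G).right_inv hy]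
  rw [this.fderiv_eq, fderiv_id]
  rfl

theorem Ad_inv_apply_Ad (a : G) (v : LieAlg E G) : Ad a⁻¹ (Ad a v) = v := by
  rw [← Ad_mul, inv_mul_cancel, Ad_one]

theorem Ad_apply_Ad_inv (a : G) (v : LieAlg E G) : Ad a (Ad a⁻¹ v) = v := by
  rw [← Ad_mul, mul_inv_cancel, Ad_one]

theorem toModel_Ad_eventually (v : LieAlg E G) :
    ∀ᶠ a : G in 𝓝 1, toModel E G (Ad a v) = localAd E G (chartOne E G a) (toModel E G v) := by
  filter_upwards [eventually_mem_source (E := E)] with a ha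
  rw [toModel_Ad, localAd, (chartOne E G).left_inv ha]

/-- Near the identity this is smoothness of `localAd`; the identity `Ad x = Ad (x a⁻¹) Ad a` carries
it to every other point `a`. -/
theorem continuous_toModel_Ad (v : LieAlg E G) : Continuous fun a : G => toModel E G (Ad a v) := by
  have := topologicalGroup_of_lieGroup 𝓘(ℝ, E) ∞ (G := G)
  have h1 : ∀ w : LieAlg E G, ContinuousAt (fun a : G => toModel E G (Ad a w)) 1 := by
    intro w
    have h2 : ContinuousAt (fun a : G => localAd E G (chartOne E G a) (toModel E G w)) 1 := by
      refine ContinuousAt.clm_apply ?_ continuousAt_const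
      exact (contDiffAt_localAd.continuousAt).comp_of_eq continuousAt_chartOne rfl
    exact h2.congr ((toModel_Ad_eventually w).mono fun a h => h.symm)
  rw [continuous_iff_continuousAt]
  intro a
  have h2 : (fun x : G => toModel E G (Ad x v)) =
      (fun x : G => toModel E G (Ad x (Ad a v))) ∘ fun x => x * a⁻¹ := by
    funext x
    simp [← Ad_mul]
  rw [h2]
  exact (h1 (Ad a v)).comp_of_eq (continuousAt_id.mul continuousAt_const) (by simp)

end LieGroup

/-! ### The bracket is the derivative of `Ad` -/

section LieGroup

variable {E : Type*} [NormedAddCommGroup E] [NormedSpace ℝ E]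
variable {G : Type*} [TopologicalSpace G] [ChartedSpace E G] [Group G]

theorem localMul_origin_right :
    (fun z => localMul (E := E) G (z, chartOrigin E G)) =ᶠ[𝓝 (chartOrigin E G)] id := by
  filter_upwards [eventually_mem_target] with z hz
  simp [localMul, (chartOne E G).right_inv hz]

theorem localMul_origin_left :
    (fun z => localMul (E := E) G (chartOrigin E G, z)) =ᶠ[𝓝 (chartOrigin E G)] id := by
  filter_upwards [eventually_mem_target] with z hz
  simp [localMul, (chartOne E G).right_inv hz]

variable [LieGroup 𝓘(ℝ, E) ∞ G]

/-- This is `x y = (x y x⁻¹) x`, valid in the chart as long as the conjugate stays in its domain. -/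
theorem localMul_eq_localMul_localConj :
    ∀ᶠ p : E × E in 𝓝 (chartOrigin E G, chartOrigin E G),
      localMul G p = localMul G (localConj ((chartOne E G).symm p.1) p.2, p.1) := by
  have := topologicalGroup_of_lieGroup 𝓘(ℝ, E) ∞ (G := G)
  have h1 : ContinuousAt (fun p : E × E => (chartOne E G).symm p.1)
      (chartOrigin E G, chartOrigin E G) :=
    (continuousAt_chartOne_symm (G := G)).comp_of_eq continuousAt_fst rfl
  have h2 : ContinuousAt (fun p : E × E => (chartOne E G).symm p.2)
      (chartOrigin E G, chartOrigin E G) :=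
    (continuousAt_chartOne_symm (G := G)).comp_of_eq continuousAt_snd rfl
  have h := ((h1.mul h2).mul h1.inv).tendsto.eventually (p := fun x => x ∈ (chartOne E G).source)
    (by simpa using eventually_mem_source)
  filter_upwards [h] with p hp
  have hp' : (chartOne E G).symm (localConj ((chartOne E G).symm p.1) p.2) =
    (chartOne E G).symm p.1 * (chartOne E G).symm p.2 * ((chartOne E G).symm p.1)⁻¹ :=
    (chartOne E G).left_inv hp
  simp only [localMul, hp']
  congr 1
  group

/-- The second derivative of the multiplication at the identity. -/
def secondDerivMul (E G : Type*) [NormedAddCommGroup E] [NormedSpace ℝ E] [TopologicalSpace G]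
    [ChartedSpace E G] [Group G] : E × E →L[ℝ] E × E →L[ℝ] E :=
  fderiv ℝ (fderiv ℝ (localMul G)) (chartOrigin E G, chartOrigin E G)

theorem hasFDerivAt_fderiv_localMul :
    HasFDerivAt (fderiv ℝ (localMul G)) (secondDerivMul E G)
      (chartOrigin E G, chartOrigin E G) :=
  ((contDiffAt_localMul.fderiv_right (m := 1) (by norm_cast)).differentiableAt
    (by simp)).hasFDerivAt

theorem secondDerivMul_symm (u v : E × E) : secondDerivMul E G u v = secondDerivMul E G v u :=
  (contDiffAt_localMul (G := G)).isSymmSndFDerivAt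
    (by rw [minSmoothness_of_isRCLikeNormedField]; exact ENat.LEInfty.out) u v

theorem fderiv_localMul_left (u : E) :
    fderiv ℝ (localMul G) (chartOrigin E G, chartOrigin E G) (u, 0) = u := by
  have h := ((contDiffAt_localMul (E := E) (G := G)).differentiableAt (by simp)).hasFDerivAt
  have h1 : HasFDerivAt (fun z : E => (z, chartOrigin E G)) (ContinuousLinearMap.inl ℝ E E)
    (chartOrigin E G) := hasFDerivAt_prodMk_left _ _
  have h2 := (HasFDerivAt.comp (f := fun z : E => (z, chartOrigin E G)) (chartOrigin E G) h h1).congr_of_eventuallyEq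
    (localMul_origin_right (E := E) (G := G)).symm
  have h3 := h2.unique (hasFDerivAt_id (chartOrigin E G))
  simpa using congrArg (fun T : E →L[ℝ] E => T u) h3

theorem fderiv_localMul_right (u : E) :
    fderiv ℝ (localMul G) (chartOrigin E G, chartOrigin E G) (0, u) = u := by
  have h := ((contDiffAt_localMul (E := E) (G := G)).differentiableAt (by simp)).hasFDerivAt
  have h1 : HasFDerivAt (fun z : E => (chartOrigin E G, z)) (ContinuousLinearMap.inr ℝ E E)
    (chartOrigin E G) := hasFDerivAt_prodMk_right _ _
  have h2 := (HasFDerivAt.comp (f := fun z : E => (chartOrigin E G, z)) (chartOrigin E G) h h1).congr_of_eventuallyEq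
    (localMul_origin_left (E := E) (G := G)).symm
  have h3 := h2.unique (hasFDerivAt_id (chartOrigin E G))
  simpa using congrArg (fun T : E →L[ℝ] E => T u) h3

theorem hasFDerivAt_fderiv_localMul_left (w : E) :
    HasFDerivAt (fun z : E => fderiv ℝ (localMul G) (z, chartOrigin E G) (0, w))
      (((secondDerivMul E G).flip (0, w)).comp (ContinuousLinearMap.inl ℝ E E))
      (chartOrigin E G) := by
  have h1 : HasFDerivAt (fun z : E => (z, chartOrigin E G)) (ContinuousLinearMap.inl ℝ E E)
    (chartOrigin E G) := hasFDerivAt_prodMk_left _ _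
  have h2 := HasFDerivAt.comp (f := fun z : E => (z, chartOrigin E G)) (chartOrigin E G)
    (hasFDerivAt_fderiv_localMul (E := E) (G := G)) h1
  convert! h2.clm_apply (hasFDerivAt_const ((0, w) : E × E) (chartOrigin E G)) using 1
  ext u
  simp

/-- The derivative of `x y = (x y x⁻¹) x` in `y` at the identity. It brings `Ad` into a relation
between first derivatives of the multiplication, which can be differentiated once more in `x`. -/
theorem fderiv_localMul_conj (w : E) :
    ∀ᶠ z : E in 𝓝 (chartOrigin E G),
      fderiv ℝ (localMul G) (z, chartOrigin E G) (0, w) =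
        fderiv ℝ (localMul G) (chartOrigin E G, z) (localAd E G z w, 0) := by
  -- Freezing the first variable `z` requires the identity for all `y` near the origin, for each `z`
  -- near the origin.
  have h0 := (localMul_eq_localMul_localConj (E := E) (G := G)).curry_nhds
  have hd : ∀ᶠ p : E × E in 𝓝 (chartOrigin E G, chartOrigin E G),
      DifferentiableAt ℝ (localMul G) p :=
    ((contDiffAt_localMul (E := E) (G := G)).of_le (m := 1)
      (by norm_cast)).eventually (by simp) |>.mono fun p hp => hp.differentiableAt (by simp)
  have hd1 : ∀ᶠ z : E in 𝓝 (chartOrigin E G),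
      DifferentiableAt ℝ (localMul G) (z, chartOrigin E G) :=
    (Continuous.prodMk_left (chartOrigin E G)).continuousAt.tendsto.eventually hd
  have hd2 : ∀ᶠ z : E in 𝓝 (chartOrigin E G),
      DifferentiableAt ℝ (localMul G) (chartOrigin E G, z) :=
    (Continuous.prodMk_right (chartOrigin E G)).continuousAt.tendsto.eventually hd
  filter_upwards [h0, hd1, hd2] with z hz h1 h2
  have e1 : HasFDerivAt (fun y : E => localMul G (z, y)) _ (chartOrigin E G) :=
    h1.hasFDerivAt.comp (chartOrigin E G) (hasFDerivAt_prodMk_right z (chartOrigin E G))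
  have e2 : HasFDerivAt (fun y : E => (localConj ((chartOne E G).symm z) y, z)) _
      (chartOrigin E G) :=
    ((contDiffAt_localConj ((chartOne E G).symm z)).differentiableAt
      (by simp)).hasFDerivAt.prodMk (hasFDerivAt_const z (chartOrigin E G))
  have e3 := HasFDerivAt.comp (g := localMul G) (chartOrigin E G)
    (by rw [localConj_origin]; exact h2.hasFDerivAt) e2
  have e4 := (e3.congr_of_eventuallyEq hz).unique e1
  simpa [localAd] using (congrArg (fun T : E →L[ℝ] E => T w) e4).symm

theorem localAd_origin (w : E) : localAd E G (chartOrigin E G) w = w := by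
  have := (fderiv_localMul_conj (E := E) (G := G) w).self_of_nhds
  rwa [fderiv_localMul_right, fderiv_localMul_left, eq_comm] at this

/-- The derivative of `Ad` at the identity, in the chart. -/
theorem fderiv_localAd (v w : E) :
    fderiv ℝ (localAd E G) (chartOrigin E G) v w =
      secondDerivMul E G (v, 0) (0, w) - secondDerivMul E G (w, 0) (0, v) := by
  have h1 : HasFDerivAt (fun z : E => (chartOrigin E G, z)) (ContinuousLinearMap.inr ℝ E E)
    (chartOrigin E G) := hasFDerivAt_prodMk_right _ _
  have h2 := HasFDerivAt.comp (f := fun z : E => (chartOrigin E G, z)) (chartOrigin E G)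
    (hasFDerivAt_fderiv_localMul (E := E) (G := G)) h1
  have hA := ((contDiffAt_localAd (E := E) (G := G)).differentiableAt (by simp)).hasFDerivAt
  have h3 := (hA.clm_apply (hasFDerivAt_const w _)).prodMk
    (hasFDerivAt_const (0 : E) (chartOrigin E G))
  have h4 := h2.clm_apply h3
  -- Differentiating `fderiv_localMul_conj` at the origin: the product rule gives one term from the
  -- moving base point and one from the derivative of `localAd`. Symmetry of the second derivative
  -- then rearranges the former.
  have h5 := (h4.congr_of_eventuallyEq (fderiv_localMul_conj w)).unique
    (hasFDerivAt_fderiv_localMul_left w)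
  have h6 := congrArg (fun T : E →L[ℝ] E => T v) h5
  simp [localAd_origin, fderiv_localMul_left] at h6
  rw [secondDerivMul_symm (w, 0), eq_sub_iff_add_eq]
  exact h6

/-- A left-invariant vector field, read in the chart at the identity. -/
theorem mpullbackWithin_mulInvariantVectorField (v : GroupLieAlgebra 𝓘(ℝ, E) G) :
    ∀ᶠ z : E in 𝓝 (chartOrigin E G),
      VectorField.mpullbackWithin 𝓘(ℝ, E) 𝓘(ℝ, E) (chartOne E G).symm
        (mulInvariantVectorField v) (Set.range 𝓘(ℝ, E)) z =
      fderiv ℝ (localMul G) (z, chartOrigin E G) (0, (v : E)) := by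
  have hd : ∀ᶠ p : E × E in 𝓝 (chartOrigin E G, chartOrigin E G),
      DifferentiableAt ℝ (localMul G) p :=
    ((contDiffAt_localMul (E := E) (G := G)).of_le (m := 1)
      (by norm_cast)).eventually (by simp) |>.mono fun p hp => hp.differentiableAt (by simp)
  have hd1 : ∀ᶠ z : E in 𝓝 (chartOrigin E G),
      DifferentiableAt ℝ (localMul G) (z, chartOrigin E G) :=
    (Continuous.prodMk_left (chartOrigin E G)).continuousAt.tendsto.eventually hd
  filter_upwards [hd1, eventually_mem_target] with z h1 hz
  have hinv := isInvertible_mfderivWithin_extChartAt_symm (I := 𝓘(ℝ, E)) (x := (1 : G)) hz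
  have hmem : (chartOne E G).symm z ∈ (chartOne E G).source := (chartOne E G).map_target hz
  have hcomp := mfderiv_extChartAt_comp_mfderivWithin_extChartAt_symm (I := 𝓘(ℝ, E))
    (x := (1 : G)) hz
  have h2 : VectorField.mpullbackWithin 𝓘(ℝ, E) 𝓘(ℝ, E) (chartOne E G).symm
        (mulInvariantVectorField v) (Set.range 𝓘(ℝ, E)) z =
      mfderiv 𝓘(ℝ, E) 𝓘(ℝ, E) (chartOne E G) ((chartOne E G).symm z)
        (mulInvariantVectorField v ((chartOne E G).symm z)) := by
    rw [VectorField.mpullbackWithin_apply]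
    refine (hinv.inverse_apply_eq).2 ?_
    exact (congrArg (fun T : E →L[ℝ] E => T (mulInvariantVectorField v ((chartOne E G).symm z)))
      (mfderivWithin_extChartAt_symm_comp_mfderiv_extChartAt (I := 𝓘(ℝ, E))
        (x := (1 : G)) hz)).symm
  rw [h2]
  set a := (chartOne E G).symm z with ha
  have hφ : MDifferentiableAt 𝓘(ℝ, E) 𝓘(ℝ, E) (chartOne E G) (a * 1) := by
    rw [mul_one]
    exact mdifferentiableAt_extChartAt (I := 𝓘(ℝ, E)) (by simpa [chartOne] using hmem)
  have hL : MDifferentiableAt 𝓘(ℝ, E) 𝓘(ℝ, E) (fun x : G => a * x) 1 :=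
    (contMDiff_mul_left (I := 𝓘(ℝ, E)) (n := ∞)).contMDiffAt.mdifferentiableAt (by simp)
  have h3 : mfderiv 𝓘(ℝ, E) 𝓘(ℝ, E) (chartOne E G) a (mulInvariantVectorField v a) =
      mfderiv 𝓘(ℝ, E) 𝓘(ℝ, E) (chartOne E G ∘ fun x : G => a * x) 1 v := by
    rw [mfderiv_comp (I' := 𝓘(ℝ, E)) 1 hφ hL]
    -- The two derivatives are based at `a * 1` and `a`, so their types agree only after rewriting
    -- the point.
    have key : ∀ (b : G) (x : E), b = a →
        (mfderiv 𝓘(ℝ, E) 𝓘(ℝ, E) (chartOne E G) a : E →L[ℝ] E) x =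
          (mfderiv 𝓘(ℝ, E) 𝓘(ℝ, E) (chartOne E G) b : E →L[ℝ] E) x := by
      rintro b x rfl
      rfl
    exact key (a * 1) _ (mul_one a)
  rw [h3, (hφ.comp 1 hL).mfderiv]
  have e1 : HasFDerivAt (fun y : E => localMul G (z, y)) _ (chartOrigin E G) :=
    h1.hasFDerivAt.comp (chartOrigin E G) (hasFDerivAt_prodMk_right z (chartOrigin E G))
  have e2 : writtenInExtChartAt 𝓘(ℝ, E) 𝓘(ℝ, E) (1 : G) (chartOne E G ∘ fun x : G => a * x) =
      fun y : E => localMul G (z, y) := by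
    funext y
    rfl
  rw [e2]
  simp only [modelWithCornersSelf_coe, Set.range_id, fderivWithin_univ]
  change fderiv ℝ (fun y : E => localMul G (z, y)) (chartOrigin E G) v = _
  rw [e1.fderiv]
  rfl

/-- The bracket on a manifold is computed in the chart and carried back by the derivative of the
chart at its own base point, which is the identity here. -/
theorem mlieBracket_one (V W : Π x : G, TangentSpace 𝓘(ℝ, E) x) :
    (VectorField.mlieBracket 𝓘(ℝ, E) V W (1 : G) : E) =
      VectorField.lieBracket ℝ
        (fun z => (VectorField.mpullbackWithin 𝓘(ℝ, E) 𝓘(ℝ, E) (chartOne E G).symm V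
          (Set.range 𝓘(ℝ, E)) z : E))
        (fun z => (VectorField.mpullbackWithin 𝓘(ℝ, E) 𝓘(ℝ, E) (chartOne E G).symm W
          (Set.range 𝓘(ℝ, E)) z : E)) (chartOrigin E G) := by
  rw [← VectorField.mlieBracketWithin_univ, VectorField.mlieBracketWithin_apply]
  have hinv : ∀ (T : E →L[ℝ] E) (x : E), T = ContinuousLinearMap.id ℝ E → T.inverse x = x := by
    rintro _ x rfl
    rw [ContinuousLinearMap.inverse_id]
    rfl
  refine (hinv _ _ mfderiv_extChartAt_self).trans ?_
  have key : ∀ (A B : E → E) (s : Set E) (x : E), s = Set.univ →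
      VectorField.lieBracketWithin ℝ A B s x = VectorField.lieBracket ℝ A B x := by
    rintro A B _ x rfl
    rw [VectorField.lieBracketWithin_univ]
  exact key _ _ _ _ (by simp)

theorem lieBracket_localMul (v w : E) :
    VectorField.lieBracket ℝ (fun z : E => fderiv ℝ (localMul G) (z, chartOrigin E G) (0, v))
      (fun z : E => fderiv ℝ (localMul G) (z, chartOrigin E G) (0, w)) (chartOrigin E G) =
    secondDerivMul E G (v, 0) (0, w) - secondDerivMul E G (w, 0) (0, v) := by
  rw [VectorField.lieBracket, (hasFDerivAt_fderiv_localMul_left _).fderiv,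
    (hasFDerivAt_fderiv_localMul_left _).fderiv, fderiv_localMul_right, fderiv_localMul_right]
  rfl

variable [FiniteDimensional ℝ E]

/-- In the chart, the left-invariant field of `v` is `z ↦ D(localMul)(z, e)(0, v)`. The result is
the expression found for the derivative of `Ad` in `fderiv_localAd`. -/
theorem toModel_bracket (v w : LieAlg E G) :
    toModel E G ⁅v, w⁆ = secondDerivMul E G (toModel E G v, 0) (0, toModel E G w) -
      secondDerivMul E G (toModel E G w, 0) (0, toModel E G v) := by
  have hv := mpullbackWithin_mulInvariantVectorField (E := E) (G := G) v
  have hw := mpullbackWithin_mulInvariantVectorField (E := E) (G := G) w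
  refine (mlieBracket_one (mulInvariantVectorField (I := 𝓘(ℝ, E)) (G := G) v)
    (mulInvariantVectorField (I := 𝓘(ℝ, E)) (G := G) w)).trans ?_
  exact (Filter.EventuallyEq.lieBracket_vectorField_eq hv hw).trans (lieBracket_localMul _ _)

/-- A curve through the identity with velocity `v`. -/
structure IsCurveWithVelocity (γ : ℝ → G) (v : LieAlg E G) : Prop where
  map_zero : γ 0 = 1
  continuousAt : ContinuousAt γ 0
  hasDerivAt : HasDerivAt (fun t => chartOne E G (γ t)) (toModel E G v) 0

theorem exists_isCurveWithVelocity (v : LieAlg E G) : ∃ γ : ℝ → G, IsCurveWithVelocity γ v := by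
  have h0 : ∀ u : E, (fun t : ℝ => chartOrigin E G + t • u) 0 = chartOrigin E G := by simp
  have hc : ContinuousAt (fun t : ℝ => chartOrigin E G + t • toModel E G v) 0 := by fun_prop
  refine ⟨fun t => (chartOne E G).symm (chartOrigin E G + t • toModel E G v), by simp,
    (continuousAt_chartOne_symm (G := G)).comp_of_eq hc (h0 _), ?_⟩
  have h1 : HasDerivAt (fun t : ℝ => chartOrigin E G + t • toModel E G v) (toModel E G v) 0 := by
    simpa using ((hasDerivAt_id (0 : ℝ)).smul_const (toModel E G v)).const_add (chartOrigin E G)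
  refine h1.congr_of_eventuallyEq ?_
  have h2 := hc.tendsto.eventually (p := fun y => y ∈ (chartOne E G).target)
    (by simpa using eventually_mem_target)
  filter_upwards [h2] with t ht
  exact (chartOne E G).right_inv ht

theorem isCurveWithVelocity_velocity {γ : ℝ → G} (h : ContMDiff 𝓘(ℝ, ℝ) 𝓘(ℝ, E) ∞ γ)
    (h0 : γ 0 = 1) : IsCurveWithVelocity γ (velocity (E := E) γ) := by
  have hd : MDifferentiableAt 𝓘(ℝ, ℝ) 𝓘(ℝ, E) γ 0 := h.contMDiffAt.mdifferentiableAt (by simp)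
  refine ⟨h0, h.continuous.continuousAt, ?_⟩
  have hφ : MDifferentiableAt 𝓘(ℝ, E) 𝓘(ℝ, E) (chartOne E G) (γ 0) := by
    rw [h0]; exact contMDiffAt_chartOne.mdifferentiableAt (n := ∞) (by simp)
  have h1 : DifferentiableAt ℝ (chartOne E G ∘ γ) 0 :=
    mdifferentiableAt_iff_differentiableAt.1 (hφ.comp 0 hd)
  have h2 : toModel E G (velocity (E := E) γ) = deriv (chartOne E G ∘ γ) 0 := by
    change (mfderiv 𝓘(ℝ, ℝ) 𝓘(ℝ, E) γ 0 : ℝ →L[ℝ] E) 1 = _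
    rw [hd.mfderiv]
    have : writtenInExtChartAt 𝓘(ℝ, ℝ) 𝓘(ℝ, E) 0 γ = chartOne E G ∘ γ := by
      simp only [writtenInExtChartAt, h0, chartOne]
      rfl
    rw [this]
    simp only [modelWithCornersSelf_coe, Set.range_id, fderivWithin_univ]
    rfl
  rw [h2]
  exact h1.hasDerivAt

/-- Chain rule, with `fderiv_localAd` and `toModel_bracket` giving the same second-order expression.
-/
theorem IsCurveWithVelocity.hasDerivAt_Ad {γ : ℝ → G} {v : LieAlg E G}
    (h : IsCurveWithVelocity γ v) (w : LieAlg E G) :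
    HasDerivAt (fun t => toModel E G (Ad (γ t) w)) (toModel E G ⁅v, w⁆) 0 := by
  have hA := ((contDiffAt_localAd (E := E) (G := G)).differentiableAt (by simp)).hasFDerivAt
  have h1 : HasDerivAt (fun t => localAd E G (chartOne E G (γ t)) (toModel E G w))
      (fderiv ℝ (localAd E G) (chartOrigin E G) (toModel E G v) (toModel E G w)) 0 := by
    have h2 := HasFDerivAt.comp_hasDerivAt (f := fun t => chartOne E G (γ t))
      (l := localAd E G) 0 (by rw [h.map_zero]; exact hA) h.hasDerivAt
    simpa using h2.clm_apply (hasDerivAt_const (0 : ℝ) (toModel E G w))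
  rw [fderiv_localAd, ← toModel_bracket] at h1
  refine h1.congr_of_eventuallyEq ?_
  have h3 := h.continuousAt.tendsto
  rw [h.map_zero] at h3
  exact h3.eventually (toModel_Ad_eventually w)

theorem IsCurveWithVelocity.conj {γ : ℝ → G} {v : LieAlg E G}
    (h : IsCurveWithVelocity γ v) (a : G) :
    IsCurveWithVelocity (fun t => a * γ t * a⁻¹) (Ad a v) := by
  have := topologicalGroup_of_lieGroup 𝓘(ℝ, E) ∞ (G := G)
  refine ⟨by simp [h.map_zero],
    (continuousAt_const.mul h.continuousAt).mul continuousAt_const, ?_⟩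
  have hd := ((contDiffAt_localConj (E := E) a).differentiableAt (by simp)).hasFDerivAt
  have h2 := HasFDerivAt.comp_hasDerivAt (f := fun t => chartOne E G (γ t))
      (l := localConj a) 0 (by rw [h.map_zero]; exact hd) h.hasDerivAt
  rw [toModel_Ad]
  refine h2.congr_of_eventuallyEq ?_
  have h3 := h.continuousAt.tendsto
  rw [h.map_zero] at h3
  filter_upwards [h3.eventually (eventually_mem_source (E := E))] with t ht
  simp [localConj, (chartOne E G).left_inv ht]

/-- Both sides are the derivative at `0` of `Ad (a γ(t) a⁻¹) (Ad a w) = Ad a (Ad (γ(t)) w)`, where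
`γ` has velocity `v`. -/
theorem Ad_bracket (a : G) (v w : LieAlg E G) : Ad a ⁅v, w⁆ = ⁅Ad a v, Ad a w⁆ := by
  obtain ⟨γ, hγ⟩ := exists_isCurveWithVelocity v
  have h1 := (hγ.conj a).hasDerivAt_Ad (Ad a w)
  simp only [← Ad_mul, inv_mul_cancel_right] at h1
  simp only [Ad_mul, toModel_Ad a] at h1
  have h2 := (fderiv ℝ (localConj a) (chartOrigin E G)).hasFDerivAt.comp_hasDerivAt 0
    (hγ.hasDerivAt_Ad w)
  apply (toModel E G).injective
  rw [toModel_Ad]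
  exact h2.unique h1

/-- `Ad a` as an automorphism of the Lie algebra. -/
def AdEquiv (a : G) : LieAlg E G ≃ₗ⁅ℝ⁆ LieAlg E G :=
  { Ad a with
    map_lie' := Ad_bracket a _ _
    invFun := Ad a⁻¹
    left_inv := Ad_inv_apply_Ad a
    right_inv := Ad_apply_Ad_inv a }

theorem killingForm_Ad (a : G) (v w : LieAlg E G) :
    killingForm ℝ (LieAlg E G) (Ad a v) (Ad a w) = killingForm ℝ (LieAlg E G) v w :=
  LieAlgebra.killingForm_of_equiv_apply (AdEquiv a) v w

/-- A subspace that is invariant under `Ad H` is invariant under `ad` of the Lie algebra of `H`. -/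
theorem AdInvariant.lie_mem {H : Subgroup G} {U : Submodule ℝ (LieAlg E G)}
    (hU : AdInvariant H U) {v u : LieAlg E G} (hv : v ∈ lieSub H) (hu : u ∈ U) : ⁅v, u⁆ ∈ U := by
  induction hv using Submodule.span_induction with
  | zero => simp
  | add x y _ _ hx hy => rw [add_lie]; exact U.add_mem hx hy
  | smul c x _ hx => rw [smul_lie]; exact U.smul_mem c hx
  | mem x hx =>
    obtain ⟨γ, h, h0, hH, rfl⟩ := hx
    have hγ := isCurveWithVelocity_velocity (E := E) h h0
    have hd := hγ.hasDerivAt_Ad u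
    have hclosed : IsClosed ((U.map (toModel E G).toLinearMap : Submodule ℝ E) : Set E) :=
      Submodule.closed_of_finiteDimensional _
    have h1 : toModel E G ⁅velocity (E := E) γ, u⁆ ∈ U.map (toModel E G).toLinearMap := by
      -- The bracket is a limit of difference quotients, all of which lie in the closed subspace
      -- `U`.
      refine hclosed.mem_of_tendsto hd.tendsto_slope ?_
      filter_upwards with t
      simp only [slope, vsub_eq_sub]
      refine Submodule.smul_mem _ _ (Submodule.sub_mem _ ?_ ?_)
      · exact Submodule.mem_map_of_mem (hU _ (hH t) _ hu)
      · exact Submodule.mem_map_of_mem (hU _ (hH 0) _ hu)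
    obtain ⟨y, hy, hye⟩ := h1
    rwa [← (toModel E G).injective hye]

end LieGroup

/-! ### Traces and orthonormal bases for a positive definite form -/

section EuclideanForm

variable {V : Type*} [AddCommGroup V] [Module ℝ V]

/-- The trace of an endomorphism, computed in an orthonormal basis. -/
theorem trace_eq_sum_form {ι : Type*} [Fintype ι] [DecidableEq ι] {Q : LinearMap.BilinForm ℝ V}
    (e : Module.Basis ι ℝ V)
    (he : ∀ i j, Q (e i) (e j) = if i = j then 1 else 0) (T : V →ₗ[ℝ] V) :
    LinearMap.trace ℝ V T = ∑ i, Q (T (e i)) (e i) := by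
  rw [LinearMap.trace_eq_matrix_trace ℝ e, Matrix.trace]
  refine Finset.sum_congr rfl fun i _ => ?_
  rw [Matrix.diag_apply, LinearMap.toMatrix_apply]
  have h : Q (T (e i)) (e i) = Q (∑ j, e.repr (T (e i)) j • e j) (e i) := by rw [e.sum_repr]
  rw [h]
  simp [he, -Module.Basis.sum_repr]

variable [FiniteDimensional ℝ V]

theorem exists_orthonormal_basis (Q : LinearMap.BilinForm ℝ V) (hs : ∀ x y, Q x y = Q y x)
    (hp : ∀ x, x ≠ 0 → 0 < Q x x) :
    ∃ e : Module.Basis (Fin (Module.finrank ℝ V)) ℝ V,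
      ∀ i j, Q (e i) (e j) = if i = j then 1 else 0 := by
  have : Invertible (2 : ℝ) := invertibleOfNonzero two_ne_zero
  obtain ⟨v, hv⟩ := LinearMap.BilinForm.exists_orthogonal_basis (B := Q) ⟨fun x y => by
    simpa using hs x y⟩
  have hpos : ∀ i, 0 < Q (v i) (v i) := fun i => hp _ (v.ne_zero i)
  have hne : ∀ i, (√(Q (v i) (v i)))⁻¹ ≠ 0 := fun i =>
    inv_ne_zero (Real.sqrt_pos.2 (hpos i)).ne'
  refine ⟨v.unitsSMul fun i => Units.mk0 _ (hne i), fun i j => ?_⟩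
  simp only [Module.Basis.unitsSMul_apply, Units.smul_def, Units.val_mk0, map_smul,
    LinearMap.smul_apply, smul_eq_mul]
  split_ifs with h
  · subst h
    have h1 := Real.mul_self_sqrt (hpos i).le
    have h2 := (Real.sqrt_pos.2 (hpos i)).ne'
    field_simp
    rw [pow_two, h1]
  · have : Q (v i) (v j) = 0 := hv h
    simp [this]

/-- In an orthonormal basis, `tr T² = -∑ Q(T eᵢ, T eᵢ)`. -/
theorem trace_mul_self_of_skew {Q : LinearMap.BilinForm ℝ V} (hs : ∀ x y, Q x y = Q y x)
    (hp : ∀ x, x ≠ 0 → 0 < Q x x) {T : V →ₗ[ℝ] V} (hT : ∀ x y, Q (T x) y = -Q x (T y))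
    (h0 : T ≠ 0) : LinearMap.trace ℝ V (T ∘ₗ T) < 0 := by
  obtain ⟨e, he⟩ := exists_orthonormal_basis Q hs hp
  have hnn : ∀ x, 0 ≤ Q x x := fun x => by
    by_cases h : x = 0
    · simp [h]
    · exact (hp x h).le
  rw [trace_eq_sum_form e he]
  simp only [LinearMap.comp_apply, hT _ (e _), Finset.sum_neg_distrib, neg_lt_zero]
  obtain ⟨i, hi⟩ : ∃ i, T (e i) ≠ 0 := by
    by_contra! h
    exact h0 (e.ext (by simpa using h))
  exact Finset.sum_pos' (fun i _ => hnn _) ⟨i, Finset.mem_univ _, hp _ hi⟩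

end EuclideanForm

/-! ### Averaging over the compact group; negativity of the Killing form -/

section LieGroup

variable {E : Type*} [NormedAddCommGroup E] [NormedSpace ℝ E] [FiniteDimensional ℝ E]
variable {G : Type*} [TopologicalSpace G] [ChartedSpace E G] [Group G]
variable [LieGroup 𝓘(ℝ, E) ∞ G]

/-- A compact group leaves an inner product on its Lie algebra invariant. -/
theorem exists_Ad_invariant_form [CompactSpace G] :
    ∃ Q : LinearMap.BilinForm ℝ (LieAlg E G), (∀ x y, Q x y = Q y x) ∧
      (∀ x, x ≠ 0 → 0 < Q x x) ∧ ∀ (a : G) (x y : LieAlg E G), Q (Ad a x) (Ad a y) = Q x y := by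
  have := topologicalGroup_of_lieGroup 𝓘(ℝ, E) ∞ (G := G)
  let _ : MeasurableSpace G := borel G
  have : BorelSpace G := ⟨rfl⟩
  let μ : MeasureTheory.Measure G := MeasureTheory.Measure.haar
  let b := Module.finBasis ℝ (LieAlg E G)
  -- The Euclidean product of a fixed basis, transported by `Ad a⁻¹`; `Q` is its Haar integral over
  -- `a`.
  let F : LieAlg E G → LieAlg E G → G → ℝ := fun x y a =>
    ∑ i, b.repr (Ad a⁻¹ x) i * b.repr (Ad a⁻¹ y) i
  have hcoord : ∀ x i, Continuous fun a : G => b.repr (Ad a⁻¹ x) i := by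
    intro x i
    have h1 : Continuous fun a : G => toModel E G (Ad a⁻¹ x) :=
      (continuous_toModel_Ad x).comp continuous_inv
    exact ((b.coord i).comp (toModel E G).symm.toLinearMap).continuous_of_finiteDimensional.comp h1
  have hF : ∀ x y, Continuous (F x y) := fun x y =>
    continuous_finsetSum _ fun i _ => (hcoord x i).mul (hcoord y i)
  have hint : ∀ x y, MeasureTheory.Integrable (F x y) μ := fun x y =>
    (hF x y).integrable_of_hasCompactSupport (HasCompactSupport.of_compactSpace _)
  let Q : LinearMap.BilinForm ℝ (LieAlg E G) := LinearMap.mk₂ ℝ (fun x y => ∫ a, F x y a ∂μ)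
    (fun x x' y => by
      rw [← MeasureTheory.integral_add (hint _ _) (hint _ _)]
      congr 1
      funext a
      simp [F, add_mul, Finset.sum_add_distrib])
    (fun c x y => by
      rw [smul_eq_mul, ← MeasureTheory.integral_const_mul]
      congr 1
      funext a
      simp [F, mul_assoc, Finset.mul_sum])
    (fun x y y' => by
      rw [← MeasureTheory.integral_add (hint _ _) (hint _ _)]
      congr 1
      funext a
      simp [F, mul_add, Finset.sum_add_distrib])
    (fun c x y => by
      rw [smul_eq_mul, ← MeasureTheory.integral_const_mul]
      congr 1
      funext a
      simp [F, mul_left_comm, Finset.mul_sum])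
  have hQ : ∀ x y, Q x y = ∫ a, F x y a ∂μ := fun x y => rfl
  refine ⟨Q, fun x y => ?_, fun x hx => ?_, fun g x y => ?_⟩
  · rw [hQ, hQ]
    simp only [F, mul_comm]
  · rw [hQ]
    -- The integrand is continuous and non-negative, and at `a = 1` it is the sum of the squared
    -- coordinates of `x`.
    refine (hF x x).integral_pos_of_hasCompactSupport_nonneg_nonzero (x := 1)
      (HasCompactSupport.of_compactSpace _) (fun a => ?_) ?_
    · exact Finset.sum_nonneg fun i _ => mul_self_nonneg _
    · simp only [F, inv_one, Ad_one]
      intro h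
      rw [Finset.sum_eq_zero_iff_of_nonneg fun i _ => mul_self_nonneg _] at h
      apply hx
      apply b.repr.injective
      ext i
      simpa using h i (Finset.mem_univ i)
  -- `F (Ad g x) (Ad g y) a = F x y (g⁻¹ a)`, so invariance of `Q` is left invariance of Haar
  -- measure.
  · rw [hQ, hQ, ← MeasureTheory.integral_mul_left_eq_self (F x y) g⁻¹]
    congr 1
    funext a
    simp [F, ← Ad_mul]

/-- An `Ad`-invariant form is invariant under `ad`. -/
theorem form_lie_of_Ad_invariant {Q : LinearMap.BilinForm ℝ (LieAlg E G)}
    (hQ : ∀ (a : G) (x y : LieAlg E G), Q (Ad a x) (Ad a y) = Q x y) (v x y : LieAlg E G) :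
    Q ⁅v, x⁆ y = -Q x ⁅v, y⁆ := by
  obtain ⟨γ, hγ⟩ := exists_isCurveWithVelocity v
  let Q' : E →ₗ[ℝ] E →ₗ[ℝ] ℝ := Q.compl₁₂ (toModel E G).symm.toLinearMap
    (toModel E G).symm.toLinearMap
  have h1 := Q'.toContinuousBilinearMap.hasDerivAt_of_bilinear (fun _ => hγ.hasDerivAt_Ad x)
    (fun _ => hγ.hasDerivAt_Ad y)
  -- The pairing is constant along the curve, so the product rule yields zero.
  have h2 : (fun t => Q'.toContinuousBilinearMap (toModel E G (Ad (γ t) x))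
      (toModel E G (Ad (γ t) y))) = fun _ => Q x y := by
    funext t
    simp [Q', hQ]
  rw [h2] at h1
  have h3 := h1.unique (hasDerivAt_const (0 : ℝ) (Q x y))
  simp [Q', hγ.map_zero, Ad_one] at h3
  linarith

/-- The Killing form of a compact semisimple Lie group is negative definite. -/
theorem killingForm_neg [CompactSpace G] [LieAlgebra.IsSemisimple ℝ (LieAlg E G)]
    (x : LieAlg E G) (hx : x ≠ 0) : killingForm ℝ (LieAlg E G) x x < 0 := by
  obtain ⟨Q, hs, hp, hQ⟩ := exists_Ad_invariant_form (E := E) (G := G)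
  rw [killingForm_apply_apply]
  refine trace_mul_self_of_skew hs hp (form_lie_of_Ad_invariant hQ x) ?_
  intro h
  apply hx
  have h1 : x ∈ LieAlgebra.center ℝ (LieAlg E G) := by
    rw [LieModule.mem_maxTrivSubmodule]
    intro y
    rw [← lie_skew, neg_eq_zero]
    exact congrArg (fun T : Module.End ℝ (LieAlg E G) => T y) h
  rwa [LieAlgebra.center_eq_bot, LieSubmodule.mem_bot] at h1

end LieGroup

/-! ### The form `B`, orthogonal projections, and Casimir operators as traces -/

section Algebraic

variable {𝔤 : Type*} [LieRing 𝔤] [LieAlgebra ℝ 𝔤]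

/-- A real Lie algebra is of compact type if its Killing form is negative definite. -/
class IsCompactType (𝔤 : Type*) [LieRing 𝔤] [LieAlgebra ℝ 𝔤] : Prop where
  killingForm_neg : ∀ x : 𝔤, x ≠ 0 → killingForm ℝ 𝔤 x x < 0

@[simp] theorem B_add_left (x x' y : 𝔤) : B (x + x') y = B x y + B x' y := by
  simp [B]; ring

@[simp] theorem B_add_right (x y y' : 𝔤) : B x (y + y') = B x y + B x y' := by
  simp [B]; ring

@[simp] theorem B_smul_left (c : ℝ) (x y : 𝔤) : B (c • x) y = c * B x y := by simp [B]

@[simp] theorem B_smul_right (c : ℝ) (x y : 𝔤) : B x (c • y) = c * B x y := by simp [B]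

@[simp] theorem B_neg_left (x y : 𝔤) : B (-x) y = -B x y := by simp [B]

@[simp] theorem B_neg_right (x y : 𝔤) : B x (-y) = -B x y := by simp [B]

@[simp] theorem B_sub_left (x x' y : 𝔤) : B (x - x') y = B x y - B x' y := by
  simp [B]; ring

@[simp] theorem B_sub_right (x y y' : 𝔤) : B x (y - y') = B x y - B x y' := by
  simp [B]; ring

@[simp] theorem B_zero_left (y : 𝔤) : B 0 y = 0 := by simp [B]

@[simp] theorem B_zero_right (y : 𝔤) : B y 0 = 0 := by simp [B]

theorem B_comm (x y : 𝔤) : B x y = B y x := by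
  simp only [B, LieModule.traceForm_comm ℝ 𝔤 𝔤 x y]

theorem B_lie_left (x y z : 𝔤) : B ⁅x, y⁆ z = B x ⁅y, z⁆ := by
  simp only [B, LieModule.traceForm_apply_lie_apply]

theorem B_lie_right (x y z : 𝔤) : B ⁅x, y⁆ z = -B y ⁅x, z⁆ := by
  rw [← lie_skew, B_neg_left, B_lie_left]

/-- This normalization produces the absolute constants in the Ricci formulas: the trace of `ad_Y²`
over `𝔫` is what `-B(Y,Y)` leaves after the traces over the summands of `𝔨`. -/
theorem B_self_eq_trace (x : 𝔤) :
    B x x = -LinearMap.trace ℝ 𝔤 (LieAlgebra.ad ℝ 𝔤 x * LieAlgebra.ad ℝ 𝔤 x) := by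
  simp only [B, killingForm_apply_apply]
  rfl

theorem mem_perp {U : Submodule ℝ 𝔤} {x : 𝔤} : x ∈ perp U ↔ ∀ u ∈ U, B u x = 0 := by
  simp only [perp, LinearMap.BilinForm.mem_orthogonal_iff, B,
    neg_eq_zero]

/-- The orthogonal projection onto `U`, as an endomorphism of `𝔤`. -/
def proj (U : Submodule ℝ 𝔤) : Module.End ℝ 𝔤 := U.subtype ∘ₗ orthProj U

@[simp] theorem coe_orthProj (U : Submodule ℝ 𝔤) (x : 𝔤) : (orthProj U x : 𝔤) = proj U x := rfl

theorem proj_mem (U : Submodule ℝ 𝔤) (x : 𝔤) : proj U x ∈ U := (orthProj U x).2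

/-- `U` and `V` are orthogonal for `B`. -/
def IsOrth (U V : Submodule ℝ 𝔤) : Prop := ∀ u ∈ U, ∀ v ∈ V, B u v = 0

theorem IsOrth.symm {U V : Submodule ℝ 𝔤} (h : IsOrth U V) : IsOrth V U :=
  fun v hv u hu => by rw [B_comm, h u hu v hv]

theorem IsOrth.sup_left {U V W : Submodule ℝ 𝔤} (h : IsOrth U W) (h' : IsOrth V W) :
    IsOrth (U ⊔ V) W := by
  intro x hx w hw
  obtain ⟨u, hu, v, hv, rfl⟩ := Submodule.mem_sup.1 hx
  rw [B_add_left, h u hu w hw, h' v hv w hw, add_zero]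

theorem IsOrth.sup_right {U V W : Submodule ℝ 𝔤} (h : IsOrth W U) (h' : IsOrth W V) :
    IsOrth W (U ⊔ V) := (h.symm.sup_left h'.symm).symm

/-- Traces over different subspaces become traces over `𝔤`, where cyclicity and additivity of
projections can be used. -/
theorem trace_mul_proj [FiniteDimensional ℝ 𝔤] {U : Submodule ℝ 𝔤} (T : Module.End ℝ 𝔤) (S : U →ₗ[ℝ] U)
    (h : ∀ x : U, orthProj U (T x) = S x) :
    LinearMap.trace ℝ 𝔤 (T * proj U) = LinearMap.trace ℝ U S := by
  have h1 : T * proj U = (T ∘ₗ U.subtype) ∘ₗ orthProj U := rfl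
  rw [h1, LinearMap.trace_comp_comm']
  congr 1
  ext x
  simp [← h]

variable [IsCompactType 𝔤]

theorem B_pos {x : 𝔤} (hx : x ≠ 0) : 0 < B x x :=
  neg_pos.2 (IsCompactType.killingForm_neg x hx)

theorem B_self_nonneg (x : 𝔤) : 0 ≤ B x x := by
  by_cases h : x = 0
  · simp [h]
  · exact (B_pos h).le

theorem B_self_eq_zero {x : 𝔤} : B x x = 0 ↔ x = 0 :=
  ⟨fun h => by_contra fun hx => (B_pos hx).ne' h, fun h => by simp [h]⟩

theorem IsOrth.disjoint {U V : Submodule ℝ 𝔤} (h : IsOrth U V) : Disjoint U V := by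
  rw [Submodule.disjoint_def]
  intro x hx hx'
  exact B_self_eq_zero.1 (h x hx x hx')

theorem eq_of_B_eq {U : Submodule ℝ 𝔤} {x y : 𝔤} (hx : x ∈ U) (hy : y ∈ U)
    (h : ∀ u ∈ U, B x u = B y u) : x = y := by
  rw [← sub_eq_zero, ← B_self_eq_zero, B_sub_left, h _ (U.sub_mem hx hy), sub_self]

variable [FiniteDimensional ℝ 𝔤]

theorem isCompl_perp (U : Submodule ℝ 𝔤) : IsCompl U (perp U) := by
  have hr : (killingForm ℝ 𝔤).IsRefl := fun x y h => by
    rwa [LieModule.traceForm_comm]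
  refine (LinearMap.BilinForm.isCompl_orthogonal_iff_disjoint hr).2 ?_
  exact IsOrth.disjoint fun u hu v hv => mem_perp.1 hv u hu

theorem proj_of_mem {U : Submodule ℝ 𝔤} {x : 𝔤} (hx : x ∈ U) : proj U x = x := by
  simp only [proj, orthProj, dif_pos (isCompl_perp U), LinearMap.comp_apply]
  exact congrArg Subtype.val (Submodule.projectionOnto_apply_left (isCompl_perp U) ⟨x, hx⟩)

theorem proj_of_perp {U : Submodule ℝ 𝔤} {x : 𝔤} (hx : ∀ u ∈ U, B u x = 0) : proj U x = 0 := by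
  simp only [proj, orthProj, dif_pos (isCompl_perp U), LinearMap.comp_apply]
  have := Submodule.projectionOnto_apply_right (isCompl_perp U) ⟨x, mem_perp.2 hx⟩
  exact congrArg Subtype.val this

theorem IsOrth.proj_eq_zero {U V : Submodule ℝ 𝔤} (h : IsOrth U V) {x : 𝔤} (hx : x ∈ V) :
    proj U x = 0 := proj_of_perp fun u hu => h u hu x hx

theorem B_sub_proj {U : Submodule ℝ 𝔤} {u : 𝔤} (hu : u ∈ U) (x : 𝔤) : B u (x - proj U x) = 0 := by
  obtain ⟨a, ha, b, hb, rfl⟩ := Submodule.mem_sup.1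
    (show x ∈ U ⊔ perp U by rw [(isCompl_perp U).sup_eq_top]; trivial)
  rw [map_add, proj_of_mem ha, proj_of_perp (mem_perp.1 hb), add_zero, add_sub_cancel_left]
  exact mem_perp.1 hb u hu

theorem B_proj_right {U : Submodule ℝ 𝔤} {u : 𝔤} (hu : u ∈ U) (x : 𝔤) :
    B u (proj U x) = B u x := by
  have := B_sub_proj hu x
  rw [B_sub_right] at this
  linarith

theorem B_proj_left {U : Submodule ℝ 𝔤} {u : 𝔤} (hu : u ∈ U) (x : 𝔤) :
    B (proj U x) u = B x u := by rw [B_comm, B_proj_right hu, B_comm]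

theorem B_proj (U : Submodule ℝ 𝔤) (x y : 𝔤) : B (proj U x) y = B x (proj U y) := by
  rw [← B_proj_right (proj_mem U x), B_proj_left (proj_mem U y)]

theorem proj_eq {U : Submodule ℝ 𝔤} {u x : 𝔤} (hu : u ∈ U) (h : ∀ w ∈ U, B w (x - u) = 0) :
    proj U x = u := by
  have := proj_of_perp h
  rwa [map_sub, proj_of_mem hu, sub_eq_zero] at this

theorem IsOrth.proj_sup {U V : Submodule ℝ 𝔤} (h : IsOrth U V) :
    proj (U ⊔ V) = proj U + proj V := by
  ext x
  refine proj_eq (Submodule.add_mem_sup (proj_mem U x) (proj_mem V x)) fun w hw => ?_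
  obtain ⟨u, hu, v, hv, rfl⟩ := Submodule.mem_sup.1 hw
  simp only [LinearMap.add_apply, B_add_left, B_sub_right, B_add_right, B_proj_right hu,
    B_proj_right hv, h u hu _ (proj_mem V x), h.symm v hv _ (proj_mem U x)]
  ring

theorem proj_top : proj (⊤ : Submodule ℝ 𝔤) = 1 := by
  ext x
  exact proj_of_mem trivial

/-- The Casimir operator of `U` as a quadratic form. -/
theorem B_casimir (U : Submodule ℝ 𝔤) (Y : 𝔤) :
    B (casimir U Y) Y = -LinearMap.trace ℝ 𝔤
      (LieAlgebra.ad ℝ 𝔤 Y * LieAlgebra.ad ℝ 𝔤 Y * proj U) := by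
  let Q : LinearMap.BilinForm ℝ U := (-killingForm ℝ 𝔤).compl₁₂ U.subtype U.subtype
  have hQ : ∀ u v, Q u v = B (u : 𝔤) v := fun u v => rfl
  obtain ⟨e, he⟩ := exists_orthonormal_basis Q (fun x y => by rw [hQ, hQ, B_comm])
    (fun x hx => by rw [hQ]; exact B_pos (by simpa using hx))
  rw [trace_mul_proj (LieAlgebra.ad ℝ 𝔤 Y * LieAlgebra.ad ℝ 𝔤 Y)
    (orthProj U ∘ₗ (LieAlgebra.ad ℝ 𝔤 Y * LieAlgebra.ad ℝ 𝔤 Y) ∘ₗ U.subtype) (fun x => rfl),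
    trace_eq_sum_form e he, casimir_eq U e (fun i j => he i j)]
  have h1 : ∀ s : Finset (Fin (Module.finrank ℝ U)), ∀ f : Fin (Module.finrank ℝ U) → 𝔤,
      B (∑ i ∈ s, f i) Y = ∑ i ∈ s, B (f i) Y := by
    intro s f
    simp [B]
  simp only [LinearMap.neg_apply, LinearMap.sum_apply, Module.End.mul_apply, LieAlgebra.ad_apply,
    B_neg_left, h1]
  congr 1
  refine Finset.sum_congr rfl fun i _ => ?_
  rw [hQ]
  simp only [LinearMap.comp_apply, Module.End.mul_apply, LieAlgebra.ad_apply,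
    Submodule.subtype_apply, coe_orthProj]
  -- Invariance of `B` exchanges the roles: `B([e,[e,Y]],Y) = -B([e,Y],[e,Y]) = B([Y,[Y,e]],e)`.
  rw [B_proj_left (e i).2, B_lie_right _ _ Y, B_lie_right Y, ← lie_skew Y (e i : 𝔤), B_neg_left,
    B_neg_right, neg_neg]

end Algebraic

/-! ### Orthogonal splittings, diagonal metrics and the Koszul formula -/

section Algebraic

variable {𝔤 : Type*} [LieRing 𝔤] [LieAlgebra ℝ 𝔤]

/-- Torsion-freeness writes the three brackets as differences of `Λ`; metricity cancels all but two
equal terms. -/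
theorem IsLeviCivita.koszul {𝔮 : Submodule ℝ 𝔤} {g : LinearMap.BilinForm ℝ 𝔮}
    (hs : ∀ v w, g v w = g w v) {Λ : 𝔮 →ₗ[ℝ] 𝔮 →ₗ[ℝ] 𝔮} (h : IsLeviCivita g Λ) (X Y Z : 𝔮) :
    2 * g (Λ X Y) Z = g (orthProj 𝔮 ⁅(X : 𝔤), (Y : 𝔤)⁆) Z - g (orthProj 𝔮 ⁅(Y : 𝔤), (Z : 𝔤)⁆) X
      + g (orthProj 𝔮 ⁅(Z : 𝔤), (X : 𝔤)⁆) Y := by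
  simp only [← h.2, map_sub, LinearMap.sub_apply]
  have h1 := h.1 X Y Z
  have h2 := h.1 Y Z X
  have h3 := h.1 Z X Y
  rw [hs Y (Λ X Z)] at h1
  rw [hs Z (Λ Y X)] at h2
  rw [hs X (Λ Z Y)] at h3
  linarith

/-- The `B`-orthogonal decomposition `𝔤 = 𝔩 ⊕ 𝔭₁ ⊕ 𝔭₂ ⊕ 𝔫`, with `𝔩 ⊕ 𝔭₁ ⊕ 𝔭₂` symmetric over
`𝔩`. -/
structure IsSplitting (l p₁ p₂ n : Submodule ℝ 𝔤) : Prop where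
  orth_l_p₁ : IsOrth l p₁
  orth_l_p₂ : IsOrth l p₂
  orth_l_n : IsOrth l n
  orth_p₁_p₂ : IsOrth p₁ p₂
  orth_p₁_n : IsOrth p₁ n
  orth_p₂_n : IsOrth p₂ n
  sup_eq_top : l ⊔ (p₁ ⊔ p₂ ⊔ n) = ⊤
  lie_p₁_p₁ : ∀ x ∈ p₁, ∀ y ∈ p₁, ⁅x, y⁆ ∈ l
  lie_p₂_p₂ : ∀ x ∈ p₂, ∀ y ∈ p₂, ⁅x, y⁆ ∈ l
  lie_p₁_p₂ : ∀ x ∈ p₁, ∀ y ∈ p₂, ⁅x, y⁆ = 0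
  lie_l_p₁ : ∀ x ∈ l, ∀ y ∈ p₁, ⁅x, y⁆ ∈ p₁
  lie_l_p₂ : ∀ x ∈ l, ∀ y ∈ p₂, ⁅x, y⁆ ∈ p₂
  lie_l_n : ∀ x ∈ l, ∀ y ∈ n, ⁅x, y⁆ ∈ n
  lie_p₁_n : ∀ x ∈ p₁, ∀ y ∈ n, ⁅x, y⁆ ∈ n
  lie_p₂_n : ∀ x ∈ p₂, ∀ y ∈ n, ⁅x, y⁆ ∈ n

theorem lie_mem_swap {U V W : Submodule ℝ 𝔤} (h : ∀ x ∈ U, ∀ y ∈ V, ⁅x, y⁆ ∈ W) :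
    ∀ y ∈ V, ∀ x ∈ U, ⁅y, x⁆ ∈ W := fun y hy x hx => by
  rw [← lie_skew]
  exact W.neg_mem (h x hx y hy)

theorem IsSplitting.swap {l p₁ p₂ n : Submodule ℝ 𝔤} (h : IsSplitting l p₁ p₂ n) :
    IsSplitting l p₂ p₁ n where
  orth_l_p₁ := h.orth_l_p₂
  orth_l_p₂ := h.orth_l_p₁
  orth_l_n := h.orth_l_n
  orth_p₁_p₂ := h.orth_p₁_p₂.symm
  orth_p₁_n := h.orth_p₂_n
  orth_p₂_n := h.orth_p₁_n
  sup_eq_top := by rw [sup_comm p₂, h.sup_eq_top]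
  lie_p₁_p₁ := h.lie_p₂_p₂
  lie_p₂_p₂ := h.lie_p₁_p₁
  lie_p₁_p₂ := fun x hx y hy => by rw [← lie_skew, h.lie_p₁_p₂ y hy x hx, neg_zero]
  lie_l_p₁ := h.lie_l_p₂
  lie_l_p₂ := h.lie_l_p₁
  lie_l_n := h.lie_l_n
  lie_p₁_n := h.lie_p₂_n
  lie_p₂_n := h.lie_p₁_n

theorem IsSplitting.orth_l_m {l p₁ p₂ n : Submodule ℝ 𝔤}
    (h : IsSplitting l p₁ p₂ n) : IsOrth l (p₁ ⊔ p₂ ⊔ n) :=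
  (h.orth_l_p₁.sup_right h.orth_l_p₂).sup_right h.orth_l_n

/-- The operator `x₁` on `𝔭₁`, `x₂` on `𝔭₂`, `y` on `𝔫`. -/
def diagOp (p₁ p₂ n : Submodule ℝ 𝔤) (x₁ x₂ y : ℝ) : Module.End ℝ 𝔤 :=
  x₁ • proj p₁ + x₂ • proj p₂ + y • proj n

/-- `g = x₁ B_𝔭₁ ⊕ x₂ B_𝔭₂ ⊕ y B_𝔫`. -/
def IsDiagMetric {𝔮 : Submodule ℝ 𝔤} (p₁ p₂ n : Submodule ℝ 𝔤) (x₁ x₂ y : ℝ)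
    (g : LinearMap.BilinForm ℝ 𝔮) : Prop :=
  ∀ v w : 𝔮, g v w = B (diagOp p₁ p₂ n x₁ x₂ y (v : 𝔤)) (w : 𝔤)

theorem IsDiagMetric.swap {𝔮 p₁ p₂ n : Submodule ℝ 𝔤} {x₁ x₂ y : ℝ} {g : LinearMap.BilinForm ℝ 𝔮}
    (h : IsDiagMetric p₁ p₂ n x₁ x₂ y g) : IsDiagMetric p₂ p₁ n x₂ x₁ y g := fun v w => by
  rw [h v w, diagOp, diagOp, add_comm (x₁ • proj p₁)]

variable [IsCompactType 𝔤] [FiniteDimensional ℝ 𝔤] {l p₁ p₂ n : Submodule ℝ 𝔤}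

namespace IsSplitting

theorem diagOp_p₁ (h : IsSplitting l p₁ p₂ n) (x₁ x₂ y : ℝ) {x : 𝔤} (hx : x ∈ p₁) :
    diagOp p₁ p₂ n x₁ x₂ y x = x₁ • x := by
  simp [diagOp, proj_of_mem hx, h.orth_p₁_p₂.symm.proj_eq_zero hx,
    h.orth_p₁_n.symm.proj_eq_zero hx]

theorem diagOp_p₂ (h : IsSplitting l p₁ p₂ n) (x₁ x₂ y : ℝ) {x : 𝔤} (hx : x ∈ p₂) :
    diagOp p₁ p₂ n x₁ x₂ y x = x₂ • x := by
  simp [diagOp, proj_of_mem hx, h.orth_p₁_p₂.proj_eq_zero hx, h.orth_p₂_n.symm.proj_eq_zero hx]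

theorem diagOp_n (h : IsSplitting l p₁ p₂ n) (x₁ x₂ y : ℝ) {x : 𝔤} (hx : x ∈ n) :
    diagOp p₁ p₂ n x₁ x₂ y x = y • x := by
  simp [diagOp, proj_of_mem hx, h.orth_p₁_n.proj_eq_zero hx, h.orth_p₂_n.proj_eq_zero hx]

theorem diagOp_l (h : IsSplitting l p₁ p₂ n) (x₁ x₂ y : ℝ) {x : 𝔤} (hx : x ∈ l) :
    diagOp p₁ p₂ n x₁ x₂ y x = 0 := by
  simp [diagOp, h.orth_l_p₁.symm.proj_eq_zero hx, h.orth_l_p₂.symm.proj_eq_zero hx,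
    h.orth_l_n.symm.proj_eq_zero hx]

theorem proj_m (h : IsSplitting l p₁ p₂ n) :
    proj (p₁ ⊔ p₂ ⊔ n) = proj p₁ + proj p₂ + proj n := by
  rw [(h.orth_p₁_n.sup_left h.orth_p₂_n).proj_sup, h.orth_p₁_p₂.proj_sup]

theorem proj_l_add_proj_m (h : IsSplitting l p₁ p₂ n) :
    proj l + proj (p₁ ⊔ p₂ ⊔ n) = 1 := by
  rw [← h.orth_l_m.proj_sup, h.sup_eq_top, proj_top]

theorem proj_n_eq (h : IsSplitting l p₁ p₂ n) :
    proj n = 1 - proj l - proj p₁ - proj p₂ := by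
  rw [← h.proj_l_add_proj_m, h.proj_m]
  abel

theorem proj_k (h : IsSplitting l p₁ p₂ n) :
    proj (l ⊔ (p₁ ⊔ p₂)) = proj l + proj p₁ + proj p₂ := by
  rw [(h.orth_l_p₁.sup_right h.orth_l_p₂).proj_sup, h.orth_p₁_p₂.proj_sup, add_assoc]

end IsSplitting

theorem B_diagOp (x₁ x₂ y : ℝ) (v w : 𝔤) :
    B (diagOp p₁ p₂ n x₁ x₂ y v) w = B v (diagOp p₁ p₂ n x₁ x₂ y w) := by
  simp [diagOp, B_proj]

theorem IsDiagMetric.symm {𝔮 : Submodule ℝ 𝔤} {x₁ x₂ y : ℝ} {g : LinearMap.BilinForm ℝ 𝔮}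
    (h : IsDiagMetric p₁ p₂ n x₁ x₂ y g) (v w : 𝔮) : g v w = g w v := by
  rw [h, h, B_diagOp, B_comm]

variable {𝔪 : Submodule ℝ 𝔤} {x₁ x₂ y : ℝ} {g : LinearMap.BilinForm ℝ 𝔪}
  {Λ : 𝔪 →ₗ[ℝ] 𝔪 →ₗ[ℝ] 𝔪}

/-- The diagonal operator kills `𝔩`, so the projections to `𝔪` in the Koszul formula can be dropped.
-/
theorem IsSplitting.diagOp_proj_m (h : IsSplitting l p₁ p₂ n) (hm : 𝔪 = p₁ ⊔ p₂ ⊔ n)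
    (x₁ x₂ y : ℝ) (v : 𝔤) :
    diagOp p₁ p₂ n x₁ x₂ y (proj 𝔪 v) = diagOp p₁ p₂ n x₁ x₂ y v := by
  have h1 : v = proj l v + proj 𝔪 v := by
    rw [hm, ← LinearMap.add_apply, h.proj_l_add_proj_m]
    rfl
  conv_rhs => rw [h1]
  rw [map_add, h.diagOp_l _ _ _ (proj_mem l v), zero_add]

/-- The Levi-Civita connection of a diagonal metric. -/
theorem IsLeviCivita.eq_of_diag (h : IsSplitting l p₁ p₂ n) (hm : 𝔪 = p₁ ⊔ p₂ ⊔ n)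
    (hg : IsDiagMetric p₁ p₂ n x₁ x₂ y g) (hpos : ∀ v, v ≠ 0 → 0 < g v v)
    (hΛ : IsLeviCivita g Λ) (X Y : 𝔪) {W : 𝔤} (hW : W ∈ 𝔪)
    (hXY : (2 : ℝ) • diagOp p₁ p₂ n x₁ x₂ y W = diagOp p₁ p₂ n x₁ x₂ y ⁅(X : 𝔤), (Y : 𝔤)⁆
      + ⁅(Y : 𝔤), diagOp p₁ p₂ n x₁ x₂ y X⁆ + ⁅(X : 𝔤), diagOp p₁ p₂ n x₁ x₂ y Y⁆) :
    Λ X Y = ⟨W, hW⟩ := by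
  -- `hXY` is the Koszul formula with `Z` stripped off: the operator is `B`-symmetric and `ad` is
  -- `B`-skew, so `Z` can always be moved to the second slot.
  have key : ∀ Z : 𝔪, g (Λ X Y) Z = g ⟨W, hW⟩ Z := by
    intro Z
    have h1 := hΛ.koszul hg.symm X Y Z
    have h2 := congrArg (fun v => B v (Z : 𝔤)) hXY
    simp only [B_smul_left, B_add_left] at h2
    rw [hg (orthProj _ _), hg (orthProj _ _), hg (orthProj _ _)] at h1
    simp only [coe_orthProj, h.diagOp_proj_m hm] at h1
    rw [B_diagOp _ _ _ ⁅(Y : 𝔤), (Z : 𝔤)⁆, B_diagOp _ _ _ ⁅(Z : 𝔤), (X : 𝔤)⁆] at h1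
    rw [B_lie_right (Y : 𝔤) (Z : 𝔤), ← lie_skew (Z : 𝔤) (X : 𝔤), B_neg_left,
      B_lie_right (X : 𝔤) (Z : 𝔤), B_comm (Z : 𝔤), B_comm (Z : 𝔤)] at h1
    rw [hg ⟨W, hW⟩]
    linarith
  by_contra hne
  have h3 := hpos _ (sub_ne_zero.2 hne)
  simp only [map_sub, LinearMap.sub_apply] at h3
  have h4 := key (Λ X Y)
  have h5 := key ⟨W, hW⟩
  rw [hg.symm (Λ X Y)] at h3
  have h6 := hg.symm (Λ X Y) ⟨W, hW⟩
  linarith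

end Algebraic

/-! ### Traces of `ad_Y²` and the Ricci tensor of a diagonal metric -/

section Algebraic

variable {𝔤 : Type*} [LieRing 𝔤] [LieAlgebra ℝ 𝔤]
  {l p₁ p₂ n 𝔪 : Submodule ℝ 𝔤} {x₁ x₂ y : ℝ} {g : LinearMap.BilinForm ℝ 𝔪}
  {Λ : 𝔪 →ₗ[ℝ] 𝔪 →ₗ[ℝ] 𝔪}

section Traces

open LieAlgebra in
theorem IsSplitting.trace_p₂ (hs : IsSplitting l p₁ p₂ n) {Y : 𝔤} (hY : Y ∈ p₁) :
    LinearMap.trace ℝ 𝔤 (ad ℝ 𝔤 Y * ad ℝ 𝔤 Y * proj p₂) = 0 := by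
  have hA2 : ad ℝ 𝔤 Y * proj p₂ = 0 := by
    ext X
    exact hs.lie_p₁_p₂ _ hY _ (proj_mem p₂ X)
  rw [mul_assoc, hA2, mul_zero, map_zero]

variable [IsCompactType 𝔤] [FiniteDimensional ℝ 𝔤]

-- For `Y ∈ 𝔭₁`, `ad_Y` exchanges `𝔩` and `𝔭₁` (it maps each into the other), so cyclicity of the
-- trace identifies the two contributions.
open LieAlgebra in
theorem IsSplitting.trace_l (hs : IsSplitting l p₁ p₂ n) {Y : 𝔤} (hY : Y ∈ p₁) :
    LinearMap.trace ℝ 𝔤 (ad ℝ 𝔤 Y * ad ℝ 𝔤 Y * proj p₁) =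
      LinearMap.trace ℝ 𝔤 (ad ℝ 𝔤 Y * ad ℝ 𝔤 Y * proj l) := by
  set A := ad ℝ 𝔤 Y with hA
  have hl1 : proj l * (A * proj p₁) = A * proj p₁ := by
    ext X
    exact proj_of_mem (hs.lie_p₁_p₁ _ hY _ (proj_mem p₁ X))
  have hl2 : proj p₁ * (A * proj l) = A * proj l := by
    ext X
    exact proj_of_mem (lie_mem_swap hs.lie_l_p₁ _ hY _ (proj_mem l X))
  calc LinearMap.trace ℝ 𝔤 (A * A * proj p₁)
      = LinearMap.trace ℝ 𝔤 ((A * proj l) * (A * proj p₁)) := by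
        rw [mul_assoc, mul_assoc, hl1]
    _ = LinearMap.trace ℝ 𝔤 ((A * proj p₁) * (A * proj l)) := LinearMap.trace_mul_comm _ _ _
    _ = LinearMap.trace ℝ 𝔤 (A * A * proj l) := by
        rw [mul_assoc, hl2, mul_assoc]

-- The Casimir eigenvalue collects the traces over `𝔩`, `𝔭₁`, `𝔭₂`. The first two are equal and the
-- third vanishes, whence the factor `1/2`.
open LieAlgebra in
theorem IsSplitting.trace_p₁ (hs : IsSplitting l p₁ p₂ n) {Y : 𝔤} (hY : Y ∈ p₁)
    {γ : ℝ} (hγ : casimir (l ⊔ (p₁ ⊔ p₂)) Y = γ • Y) :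
    LinearMap.trace ℝ 𝔤 (ad ℝ 𝔤 Y * ad ℝ 𝔤 Y * proj p₁) = -(γ * B Y Y) / 2 := by
  have hc := congrArg (fun v => B v Y) hγ
  simp only [B_casimir, B_smul_left, hs.proj_k, mul_add, map_add] at hc
  rw [← hs.trace_l hY, hs.trace_p₂ hY] at hc
  linarith

open LieAlgebra in
/-- `tr (ad_Y P_U ad_Y P_𝔫) = tr (ad_Y ad_Y P_U)` if `ad_Y` maps `U` to `𝔫`. -/
theorem trace_ad_proj_ad_proj {U n : Submodule ℝ 𝔤} {Y : 𝔤}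
    (hU : ∀ u ∈ U, ⁅Y, u⁆ ∈ n) :
    LinearMap.trace ℝ 𝔤 (ad ℝ 𝔤 Y * proj U * ad ℝ 𝔤 Y * proj n) =
      LinearMap.trace ℝ 𝔤 (ad ℝ 𝔤 Y * ad ℝ 𝔤 Y * proj U) := by
  have h1 : proj n * (ad ℝ 𝔤 Y * proj U) = ad ℝ 𝔤 Y * proj U := by
    ext X
    exact proj_of_mem (hU _ (proj_mem U X))
  rw [LinearMap.trace_mul_comm, ← mul_assoc, h1, LinearMap.trace_mul_comm, mul_assoc]

end Traces

/-- `Λ` is the Levi-Civita connection of the metric `x₁ B_𝔭₁ ⊕ x₂ B_𝔭₂ ⊕ y B_𝔫`. -/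
structure IsDiagLeviCivita (l p₁ p₂ n : Submodule ℝ 𝔤) (x₁ x₂ y : ℝ)
    (g : LinearMap.BilinForm ℝ 𝔪) (Λ : 𝔪 →ₗ[ℝ] 𝔪 →ₗ[ℝ] 𝔪) : Prop where
  splitting : IsSplitting l p₁ p₂ n
  eq_sup : 𝔪 = p₁ ⊔ p₂ ⊔ n
  diag : IsDiagMetric p₁ p₂ n x₁ x₂ y g
  pos : ∀ v, v ≠ 0 → 0 < g v v
  leviCivita : IsLeviCivita g Λ
  y_pos : 0 < y

namespace IsDiagLeviCivita

theorem swap (h : IsDiagLeviCivita l p₁ p₂ n x₁ x₂ y g Λ) :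
    IsDiagLeviCivita l p₂ p₁ n x₂ x₁ y g Λ where
  splitting := h.splitting.swap
  eq_sup := by rw [sup_comm p₂, h.eq_sup]
  diag := h.diag.swap
  pos := h.pos
  leviCivita := h.leviCivita
  y_pos := h.y_pos

theorem p₁_le (h : IsDiagLeviCivita l p₁ p₂ n x₁ x₂ y g Λ) : p₁ ≤ 𝔪 := by
  rw [h.eq_sup]; exact le_sup_left.trans le_sup_left

theorem p₂_le (h : IsDiagLeviCivita l p₁ p₂ n x₁ x₂ y g Λ) : p₂ ≤ 𝔪 := h.swap.p₁_le

theorem n_le (h : IsDiagLeviCivita l p₁ p₂ n x₁ x₂ y g Λ) : n ≤ 𝔪 := by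
  rw [h.eq_sup]; exact le_sup_right

theorem orth_l (h : IsDiagLeviCivita l p₁ p₂ n x₁ x₂ y g Λ) : IsOrth l 𝔪 := by
  rw [h.eq_sup]; exact h.splitting.orth_l_m

variable [IsCompactType 𝔤] [FiniteDimensional ℝ 𝔤]

theorem proj_m (h : IsDiagLeviCivita l p₁ p₂ n x₁ x₂ y g Λ) :
    proj 𝔪 = proj p₁ + proj p₂ + proj n := by rw [h.eq_sup, h.splitting.proj_m]

theorem proj_l_add_proj_m (h : IsDiagLeviCivita l p₁ p₂ n x₁ x₂ y g Λ) :
    proj l + proj 𝔪 = 1 := by rw [h.eq_sup, h.splitting.proj_l_add_proj_m]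

/-- `[X,Y]` lies in `𝔩`, which the metric does not see, and the two remaining Koszul terms cancel
because `X` and `Y` carry the same factor `x₁`. -/
theorem apply_p₁_p₁ (h : IsDiagLeviCivita l p₁ p₂ n x₁ x₂ y g Λ) {X Y : 𝔪}
    (hX : (X : 𝔤) ∈ p₁) (hY : (Y : 𝔤) ∈ p₁) : Λ X Y = 0 := by
  refine IsLeviCivita.eq_of_diag h.splitting h.eq_sup h.diag h.pos h.leviCivita X Y 𝔪.zero_mem ?_
  rw [h.splitting.diagOp_p₁ _ _ _ hX, h.splitting.diagOp_p₁ _ _ _ hY,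
    h.splitting.diagOp_l _ _ _ (h.splitting.lie_p₁_p₁ _ hX _ hY), lie_smul, lie_smul,
    ← lie_skew (X : 𝔤) (Y : 𝔤), map_zero]
  module

theorem apply_p₁_p₂ (h : IsDiagLeviCivita l p₁ p₂ n x₁ x₂ y g Λ) {X Y : 𝔪}
    (hX : (X : 𝔤) ∈ p₁) (hY : (Y : 𝔤) ∈ p₂) : Λ X Y = 0 := by
  refine IsLeviCivita.eq_of_diag h.splitting h.eq_sup h.diag h.pos h.leviCivita X Y 𝔪.zero_mem ?_
  rw [h.splitting.diagOp_p₁ _ _ _ hX, h.splitting.diagOp_p₂ _ _ _ hY, lie_smul, lie_smul,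
    ← lie_skew (Y : 𝔤), h.splitting.lie_p₁_p₂ _ hX _ hY]
  simp

/-- The Koszul terms contribute `y - x₁ + y` times `[X,Y]`, to be divided by `2y`. With the
arguments exchanged they contribute `y - y + x₁`, which explains the coefficient of `apply_n_p₁`. -/
theorem apply_p₁_n (h : IsDiagLeviCivita l p₁ p₂ n x₁ x₂ y g Λ) {X Y : 𝔪}
    (hX : (X : 𝔤) ∈ p₁) (hY : (Y : 𝔤) ∈ n) :
    (Λ X Y : 𝔤) = (1 - x₁ / (2 * y)) • ⁅(X : 𝔤), (Y : 𝔤)⁆ := by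
  have hn := h.splitting.lie_p₁_n _ hX _ hY
  have hy := h.y_pos.ne'
  rw [IsLeviCivita.eq_of_diag h.splitting h.eq_sup h.diag h.pos h.leviCivita X Y
    (h.n_le (n.smul_mem (1 - x₁ / (2 * y)) hn)) ?_]
  rw [map_smul, h.splitting.diagOp_p₁ _ _ _ hX, h.splitting.diagOp_n _ _ _ hY,
    h.splitting.diagOp_n _ _ _ hn, lie_smul, lie_smul, ← lie_skew (Y : 𝔤)]
  simp only [smul_smul, smul_neg, ← neg_smul, ← add_smul]
  congr 1
  field_simp
  ring

theorem apply_n_p₁ (h : IsDiagLeviCivita l p₁ p₂ n x₁ x₂ y g Λ) {X Y : 𝔪}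
    (hX : (X : 𝔤) ∈ n) (hY : (Y : 𝔤) ∈ p₁) :
    (Λ X Y : 𝔤) = (x₁ / (2 * y)) • ⁅(X : 𝔤), (Y : 𝔤)⁆ := by
  have hn := lie_mem_swap h.splitting.lie_p₁_n _ hX _ hY
  have hy := h.y_pos.ne'
  rw [IsLeviCivita.eq_of_diag h.splitting h.eq_sup h.diag h.pos h.leviCivita X Y
    (h.n_le (n.smul_mem (x₁ / (2 * y)) hn)) ?_]
  rw [map_smul, h.splitting.diagOp_p₁ _ _ _ hY, h.splitting.diagOp_n _ _ _ hX,
    h.splitting.diagOp_n _ _ _ hn, lie_smul, lie_smul, ← lie_skew (Y : 𝔤)]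
  simp only [smul_smul, smul_neg, ← neg_smul, ← add_smul]
  congr 1
  field_simp
  ring

theorem apply_n_n (h : IsDiagLeviCivita l p₁ p₂ n x₁ x₂ y g Λ) {X Y : 𝔪}
    (hX : (X : 𝔤) ∈ n) (hY : (Y : 𝔤) ∈ n) :
    (Λ X Y : 𝔤) = (1 / 2 : ℝ) • proj 𝔪 ⁅(X : 𝔤), (Y : 𝔤)⁆ := by
  rw [IsLeviCivita.eq_of_diag h.splitting h.eq_sup h.diag h.pos h.leviCivita X Y
    (𝔪.smul_mem (1 / 2 : ℝ) (proj_mem 𝔪 ⁅(X : 𝔤), (Y : 𝔤)⁆)) ?_]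
  rw [map_smul, h.splitting.diagOp_n _ _ _ hY, h.splitting.diagOp_n _ _ _ hX,
    h.splitting.diagOp_proj_m h.eq_sup, lie_smul, lie_smul, ← lie_skew (Y : 𝔤) (X : 𝔤)]
  module

/-- The trace of an endomorphism of `𝔪` that is given on `𝔭₁`, `𝔭₂` and `𝔫`. -/
theorem trace_eq (h : IsDiagLeviCivita l p₁ p₂ n x₁ x₂ y g Λ) (R : 𝔪 →ₗ[ℝ] 𝔪)
    (S₁ S₂ S₃ : Module.End ℝ 𝔤) (h₁ : ∀ X : 𝔪, (X : 𝔤) ∈ p₁ → (R X : 𝔤) = S₁ X)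
    (h₂ : ∀ X : 𝔪, (X : 𝔤) ∈ p₂ → (R X : 𝔤) = S₂ X)
    (h₃ : ∀ X : 𝔪, (X : 𝔤) ∈ n → (R X : 𝔤) = S₃ X) :
    LinearMap.trace ℝ 𝔪 R = LinearMap.trace ℝ 𝔤 (S₁ * proj p₁) +
      LinearMap.trace ℝ 𝔤 (S₂ * proj p₂) + LinearMap.trace ℝ 𝔤 (S₃ * proj n) := by
  have h4 : 𝔪.subtype ∘ₗ R ∘ₗ orthProj 𝔪 = S₁ * proj p₁ + S₂ * proj p₂ + S₃ * proj n := by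
    ext X
    have h5 : orthProj 𝔪 X = ⟨proj p₁ X, h.p₁_le (proj_mem p₁ X)⟩ +
        ⟨proj p₂ X, h.p₂_le (proj_mem p₂ X)⟩ + ⟨proj n X, h.n_le (proj_mem n X)⟩ := by
      apply Subtype.ext
      simp [h.proj_m]
    simp only [LinearMap.comp_apply, h5, map_add, LinearMap.add_apply, Module.End.mul_apply,
      Submodule.subtype_apply, h₁ ⟨_, h.p₁_le (proj_mem p₁ X)⟩ (proj_mem p₁ X),
      h₂ ⟨_, h.p₂_le (proj_mem p₂ X)⟩ (proj_mem p₂ X),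
      h₃ ⟨_, h.n_le (proj_mem n X)⟩ (proj_mem n X)]
  rw [← map_add, ← map_add, ← h4, LinearMap.trace_comp_comm', LinearMap.comp_assoc]
  congr 1
  ext X
  have h6 : orthProj 𝔪 (X : 𝔤) = X := Subtype.ext (proj_of_mem X.2)
  simp [h6]

-- Since `Λ(Y)Y = 0`, the operator `X ↦ R(X,Y)Y` is `-ad_Y²` on `𝔭₁`, zero on `𝔭₂`, and `-t² ad_Y²`
-- on `𝔫` with `t = x₁/(2y)`. The traces of `ad_Y²` over `𝔭₁` and `𝔫` are `-γ/2` and `-(1 - γ)`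
-- times `B(Y,Y)`.
open LieAlgebra in
theorem ricci_p₁ (h : IsDiagLeviCivita l p₁ p₂ n x₁ x₂ y g Λ) {Y : 𝔪} (hY : (Y : 𝔤) ∈ p₁)
    {γ : ℝ} (hγ : casimir (l ⊔ (p₁ ⊔ p₂)) (Y : 𝔤) = γ • (Y : 𝔤)) :
    ricci Λ Y Y = (γ / 2 + (x₁ / (2 * y)) ^ 2 * (1 - γ)) * B (Y : 𝔤) Y := by
  have hs := h.splitting
  have hyy : Λ Y Y = 0 := h.apply_p₁_p₁ hY hY
  have h1 : ∀ X : 𝔪, ⁅(X : 𝔤), (Y : 𝔤)⁆ ∈ l →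
      ⁅⁅(X : 𝔤), (Y : 𝔤)⁆, (Y : 𝔤)⁆ ∈ p₁ → Λ X Y = 0 →
      (curvature Λ Y Y X : 𝔤) = -(ad ℝ 𝔤 (Y : 𝔤) * ad ℝ 𝔤 (Y : 𝔤)) (X : 𝔤) := by
    intro X hX hX' hXY
    have h2 : proj 𝔪 ⁅(X : 𝔤), (Y : 𝔤)⁆ = 0 := h.orth_l.symm.proj_eq_zero hX
    have h3 : orthProj 𝔪 ⁅(X : 𝔤), (Y : 𝔤)⁆ = 0 := Subtype.ext h2
    simp only [curvature, LinearMap.coe_mk, AddHom.coe_mk, hyy, hXY, h3, map_zero,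
      LinearMap.zero_apply, Submodule.coe_sub, sub_zero, zero_sub,
      coe_orthProj]
    rw [h2, sub_zero, proj_of_mem (h.p₁_le hX'), Submodule.coe_neg, Submodule.coe_zero, neg_zero,
      zero_sub, Module.End.mul_apply, ad_apply, ad_apply,
      ← lie_skew (X : 𝔤), neg_lie, lie_skew]
  have e1 : ∀ X : 𝔪, (X : 𝔤) ∈ p₁ →
      (curvature Λ Y Y X : 𝔤) = (-(ad ℝ 𝔤 (Y : 𝔤) * ad ℝ 𝔤 (Y : 𝔤))) (X : 𝔤) := fun X hX =>
    h1 X (hs.lie_p₁_p₁ _ hX _ hY) (hs.lie_l_p₁ _ (hs.lie_p₁_p₁ _ hX _ hY) _ hY)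
      (h.apply_p₁_p₁ hX hY)
  have e2 : ∀ X : 𝔪, (X : 𝔤) ∈ p₂ → (curvature Λ Y Y X : 𝔤) = (0 : Module.End ℝ 𝔤) (X : 𝔤) := by
    intro X hX
    have h0 := hs.swap.lie_p₁_p₂ _ hX _ hY
    rw [h1 X (by rw [h0]; exact l.zero_mem) (by rw [h0, zero_lie]; exact p₁.zero_mem)
      (h.swap.apply_p₁_p₂ hX hY), Module.End.mul_apply, ad_apply, ad_apply, ← lie_skew (Y : 𝔤) X,
      h0]
    simp
  have e3 : ∀ X : 𝔪, (X : 𝔤) ∈ n → (curvature Λ Y Y X : 𝔤) =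
      -- With `t = x₁/(2y)`, the coefficient is `t(1 - t)` from `-Λ(Y)Λ(X)Y` plus `-t` from
      -- `-Λ([X,Y])Y`.
      (-(x₁ / (2 * y)) ^ 2 • (ad ℝ 𝔤 (Y : 𝔤) * ad ℝ 𝔤 (Y : 𝔤))) (X : 𝔤) := by
    intro X hX
    have hn := lie_mem_swap hs.lie_p₁_n _ hX _ hY
    have h2 : proj 𝔪 ⁅(X : 𝔤), (Y : 𝔤)⁆ = ⁅(X : 𝔤), (Y : 𝔤)⁆ := proj_of_mem (h.n_le hn)
    have h3 : orthProj 𝔪 ⁅(X : 𝔤), (Y : 𝔤)⁆ = ⟨⁅(X : 𝔤), (Y : 𝔤)⁆, h.n_le hn⟩ := Subtype.ext h2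
    have h4 : Λ X Y = (x₁ / (2 * y)) • (⟨⁅(X : 𝔤), (Y : 𝔤)⁆, h.n_le hn⟩ : 𝔪) :=
      Subtype.ext (h.apply_n_p₁ hX hY)
    simp only [curvature, LinearMap.coe_mk, AddHom.coe_mk, hyy, h4, h3, map_zero, map_smul,
      zero_sub, sub_self, zero_lie, sub_zero, Submodule.coe_sub, Submodule.coe_neg,
      Submodule.coe_smul]
    rw [h.apply_p₁_n (Y := ⟨⁅(X : 𝔤), (Y : 𝔤)⁆, h.n_le hn⟩) hY hn,
      h.apply_n_p₁ (X := ⟨⁅(X : 𝔤), (Y : 𝔤)⁆, h.n_le hn⟩) hn hY]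
    simp only [LinearMap.smul_apply, Module.End.mul_apply, ad_apply]
    rw [← lie_skew (X : 𝔤) (Y : 𝔤), lie_neg, neg_lie,
      lie_skew (Y : 𝔤) ⁅(Y : 𝔤), (X : 𝔤)⁆]
    module
  rw [ricci, h.trace_eq _ _ _ _ e1 e2 e3]
  have hq := B_self_eq_trace (Y : 𝔤)
  have t1 := hs.trace_l hY
  have t2 := hs.trace_p₂ hY
  have hP := hs.trace_p₁ hY hγ
  set A := ad ℝ 𝔤 (Y : 𝔤) with hA
  have t3 : LinearMap.trace ℝ 𝔤 (A * A * proj n) = LinearMap.trace ℝ 𝔤 (A * A) -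
      LinearMap.trace ℝ 𝔤 (A * A * proj l) - LinearMap.trace ℝ 𝔤 (A * A * proj p₁) -
      LinearMap.trace ℝ 𝔤 (A * A * proj p₂) := by
    rw [hs.proj_n_eq]
    simp only [mul_sub, mul_one, map_sub]
  rw [zero_mul, map_zero, neg_mul, smul_mul_assoc, map_neg, map_smul, t3, smul_eq_mul, ← t1, t2]
  have hT : LinearMap.trace ℝ 𝔤 (A * A) = -B (Y : 𝔤) Y := by linarith
  rw [hT, hP]
  ring

-- Again `Λ(Y)Y = 0`. On `𝔭ₐ` the curvature operator has coefficient `-tₐ/2`. On `𝔫` the bracket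
-- `[X,Y]` splits along `𝔩`, `𝔭₁`, `𝔭₂`, `𝔫`, with weights `1`, `1 - 3tₐ/2` and `1/4`. The traces
-- over `𝔩` and `𝔭ₐ` are `-(c - b₁ - b₂)` and `-bₐ` times `B(Y,Y)`.
open LieAlgebra in
theorem ricci_n (h : IsDiagLeviCivita l p₁ p₂ n x₁ x₂ y g Λ) {Y : 𝔪} (hY : (Y : 𝔤) ∈ n)
    {c b₁ b₂ : ℝ} (hc : casimir (l ⊔ (p₁ ⊔ p₂)) (Y : 𝔤) = c • (Y : 𝔤))
    (hb₁ : casimir p₁ (Y : 𝔤) = b₁ • (Y : 𝔤)) (hb₂ : casimir p₂ (Y : 𝔤) = b₂ • (Y : 𝔤)) :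
    ricci Λ Y Y = (1 / 4 + c / 2 - x₁ / (2 * y) * b₁ - x₂ / (2 * y) * b₂) * B (Y : 𝔤) Y := by
  have hs := h.splitting
  have hyy : Λ Y Y = 0 := by
    apply Subtype.ext
    rw [h.apply_n_n hY hY, lie_self, map_zero, smul_zero, Submodule.coe_zero]
  -- Stated for an arbitrary pair of summands, so that `h.swap` gives the same formula on `𝔭₂`.
  have hp : ∀ {p₁ p₂ : Submodule ℝ 𝔤} {x₁ x₂ : ℝ}, IsDiagLeviCivita l p₁ p₂ n x₁ x₂ y g Λ →
      ∀ X : 𝔪, (X : 𝔤) ∈ p₁ → (curvature Λ Y Y X : 𝔤) =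
      ((-(x₁ / (2 * y) / 2)) • (proj 𝔪 * ad ℝ 𝔤 (Y : 𝔤) * ad ℝ 𝔤 (Y : 𝔤))) (X : 𝔤) := by
    intro p₁ p₂ x₁ x₂ h X hX
    have hn := h.splitting.lie_p₁_n _ hX _ hY
    have h2 : proj 𝔪 ⁅(X : 𝔤), (Y : 𝔤)⁆ = ⁅(X : 𝔤), (Y : 𝔤)⁆ := proj_of_mem (h.n_le hn)
    have h3 : orthProj 𝔪 ⁅(X : 𝔤), (Y : 𝔤)⁆ = ⟨⁅(X : 𝔤), (Y : 𝔤)⁆, h.n_le hn⟩ := Subtype.ext h2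
    have h4 : Λ X Y = (1 - x₁ / (2 * y)) • (⟨⁅(X : 𝔤), (Y : 𝔤)⁆, h.n_le hn⟩ : 𝔪) :=
      Subtype.ext (h.apply_p₁_n hX hY)
    simp only [curvature, LinearMap.coe_mk, AddHom.coe_mk, hyy, h4, h3, map_zero, map_smul,
      zero_sub, sub_self, zero_lie, sub_zero, Submodule.coe_sub, Submodule.coe_neg,
      Submodule.coe_smul]
    rw [h.apply_n_n (Y := ⟨⁅(X : 𝔤), (Y : 𝔤)⁆, h.n_le hn⟩) hY hn,
      h.apply_n_n (X := ⟨⁅(X : 𝔤), (Y : 𝔤)⁆, h.n_le hn⟩) hn hY]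
    simp only [LinearMap.smul_apply, Module.End.mul_apply, ad_apply]
    rw [← lie_skew (X : 𝔤) (Y : 𝔤), lie_neg, neg_lie,
      lie_skew (Y : 𝔤) ⁅(Y : 𝔤), (X : 𝔤)⁆, map_neg]
    module
  have hn : ∀ X : 𝔪, (X : 𝔤) ∈ n → (curvature Λ Y Y X : 𝔤) =
      (-((1 / 4 : ℝ) • (proj 𝔪 * ad ℝ 𝔤 (Y : 𝔤) * proj n * ad ℝ 𝔤 (Y : 𝔤))
        + (1 - 3 / 2 * (x₁ / (2 * y))) • (ad ℝ 𝔤 (Y : 𝔤) * proj p₁ * ad ℝ 𝔤 (Y : 𝔤))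
        + (1 - 3 / 2 * (x₂ / (2 * y))) • (ad ℝ 𝔤 (Y : 𝔤) * proj p₂ * ad ℝ 𝔤 (Y : 𝔤))
        + ad ℝ 𝔤 (Y : 𝔤) * proj l * ad ℝ 𝔤 (Y : 𝔤))) (X : 𝔤) := by
    intro X hX
    set b := ⁅(X : 𝔤), (Y : 𝔤)⁆ with hb
    have hb' : ⁅(Y : 𝔤), (X : 𝔤)⁆ = -b := (lie_skew _ _).symm
    set P₁ : 𝔪 := ⟨proj p₁ b, h.p₁_le (proj_mem p₁ b)⟩ with hP₁
    set P₂ : 𝔪 := ⟨proj p₂ b, h.p₂_le (proj_mem p₂ b)⟩ with hP₂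
    set N : 𝔪 := ⟨proj n b, h.n_le (proj_mem n b)⟩ with hN
    have h3 : orthProj 𝔪 b = P₁ + P₂ + N := by
      apply Subtype.ext
      simp [h.proj_m, hP₁, hP₂, hN]
    have h4 : Λ X Y = (1 / 2 : ℝ) • (P₁ + P₂ + N) := by
      rw [← h3]
      exact Subtype.ext (h.apply_n_n hX hY)
    have h5 : b - proj 𝔪 b = proj l b := by
      rw [sub_eq_iff_eq_add, ← LinearMap.add_apply, h.proj_l_add_proj_m]
      rfl
    have h6 : proj 𝔪 ⁅proj l b, (Y : 𝔤)⁆ = -⁅(Y : 𝔤), proj l b⁆ := by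
      rw [proj_of_mem (h.n_le (hs.lie_l_n _ (proj_mem l b) _ hY)), lie_skew]
    have h7 : proj 𝔪 ⁅(N : 𝔤), (Y : 𝔤)⁆ = -proj 𝔪 ⁅(Y : 𝔤), (N : 𝔤)⁆ := by
      rw [← map_neg, lie_skew]
    simp only [curvature, LinearMap.coe_mk, AddHom.coe_mk, hyy, ← hb, h4, map_zero, map_smul,
      zero_sub, Submodule.coe_sub, Submodule.coe_neg, Submodule.coe_smul, coe_orthProj, h5, h6,
      h3, map_add, LinearMap.add_apply, Submodule.coe_add]
    rw [h.apply_n_p₁ (Y := P₁) hY (proj_mem p₁ b), h.swap.apply_n_p₁ (Y := P₂) hY (proj_mem p₂ b),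
      h.apply_n_n (Y := N) hY (proj_mem n b), h.apply_p₁_n (X := P₁) (proj_mem p₁ b) hY,
      h.swap.apply_p₁_n (X := P₂) (proj_mem p₂ b) hY, h.apply_n_n (X := N) (proj_mem n b) hY,
      h7, ← lie_skew (P₁ : 𝔤), ← lie_skew (P₂ : 𝔤)]
    simp only [LinearMap.smul_apply, LinearMap.neg_apply, LinearMap.add_apply,
      Module.End.mul_apply, ad_apply, hb', map_neg, hP₁, hP₂, hN]
    module
  rw [ricci, h.trace_eq _ _ _ _ (hp h) (hp h.swap) hn]
  have hc' := congrArg (fun v => B v (Y : 𝔤)) hc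
  have hb₁' := congrArg (fun v => B v (Y : 𝔤)) hb₁
  have hb₂' := congrArg (fun v => B v (Y : 𝔤)) hb₂
  simp only [B_casimir, B_smul_left, hs.proj_k, mul_add, map_add] at hc' hb₁' hb₂'
  have hq := B_self_eq_trace (Y : 𝔤)
  have tl := trace_ad_proj_ad_proj (lie_mem_swap hs.lie_l_n _ hY)
  have t₁ := trace_ad_proj_ad_proj (lie_mem_swap hs.lie_p₁_n _ hY)
  have t₂ := trace_ad_proj_ad_proj (lie_mem_swap hs.lie_p₂_n _ hY)
  set A := ad ℝ 𝔤 (Y : 𝔤) with hA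
  -- The projections to `𝔪` left by the curvature do not affect traces restricted to a subspace of
  -- `𝔪`.
  have hmU : ∀ U ≤ 𝔪, ∀ T : Module.End ℝ 𝔤,
      LinearMap.trace ℝ 𝔤 (proj 𝔪 * T * proj U) = LinearMap.trace ℝ 𝔤 (T * proj U) := by
    intro U hU T
    have h8 : proj U * proj 𝔪 = proj U := by
      ext X
      refine proj_eq (proj_mem U _) fun w hw => ?_
      rw [B_sub_right, B_proj_right hw, B_proj_right (hU hw), sub_self]
    rw [mul_assoc, LinearMap.trace_mul_comm, mul_assoc, h8]
  -- The doubly projected trace is the full one less the parts of the intermediate bracket in `𝔩`,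
  -- `𝔭₁`, `𝔭₂`; its value is `-(1 - 2c) B(Y,Y)`.
  have tn : LinearMap.trace ℝ 𝔤 (A * proj n * A * proj n) =
      LinearMap.trace ℝ 𝔤 (A * A * proj n) - LinearMap.trace ℝ 𝔤 (A * proj l * A * proj n) -
      LinearMap.trace ℝ 𝔤 (A * proj p₁ * A * proj n) -
      LinearMap.trace ℝ 𝔤 (A * proj p₂ * A * proj n) := by
    have : A * proj n * A * proj n = A * A * proj n - A * proj l * A * proj n -
        A * proj p₁ * A * proj n - A * proj p₂ * A * proj n := by
      conv_lhs => enter [1, 1]; rw [hs.proj_n_eq]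
      simp only [mul_sub, sub_mul, mul_one]
    rw [this, map_sub, map_sub, map_sub]
  have tn' : LinearMap.trace ℝ 𝔤 (A * A * proj n) = LinearMap.trace ℝ 𝔤 (A * A) -
      LinearMap.trace ℝ 𝔤 (A * A * proj l) - LinearMap.trace ℝ 𝔤 (A * A * proj p₁) -
      LinearMap.trace ℝ 𝔤 (A * A * proj p₂) := by
    rw [hs.proj_n_eq]
    simp only [mul_sub, mul_one, map_sub]
  have tm₁ := hmU p₁ h.p₁_le (A * A)
  have tm₂ := hmU p₂ h.p₂_le (A * A)
  have tmn := hmU n h.n_le (A * proj n * A)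
  simp only [← mul_assoc] at tm₁ tm₂ tmn
  simp only [smul_mul_assoc, neg_mul, add_mul, map_neg, map_add, map_smul, smul_eq_mul,
    tm₁, tm₂, tmn, tn, tn', tl, t₁, t₂]
  have r₁ : LinearMap.trace ℝ 𝔤 (A * A * proj p₁) = -(b₁ * B (Y : 𝔤) Y) := by linarith
  have r₂ : LinearMap.trace ℝ 𝔤 (A * A * proj p₂) = -(b₂ * B (Y : 𝔤) Y) := by linarith
  have rl : LinearMap.trace ℝ 𝔤 (A * A * proj l) = -((c - b₁ - b₂) * B (Y : 𝔤) Y) := by linarith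
  have rq : LinearMap.trace ℝ 𝔤 (A * A) = -B (Y : 𝔤) Y := by linarith
  rw [r₁, r₂, rl, rq]
  ring

end IsDiagLeviCivita

end Algebraic

/-! ### The symmetric fiber; positivity of Casimir eigenvalues -/

section Algebraic

variable {𝔤 : Type*} [LieRing 𝔤] [LieAlgebra ℝ 𝔤] [IsCompactType 𝔤] [FiniteDimensional ℝ 𝔤]
  {l p₁ p₂ n 𝔭 : Submodule ℝ 𝔤}

open LieAlgebra in
/-- The Ricci tensor of the symmetric fiber. -/
theorem IsSplitting.ricci_fiber (hs : IsSplitting l p₁ p₂ n) (h𝔭 : 𝔭 = p₁ ⊔ p₂)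
    {g : LinearMap.BilinForm ℝ 𝔭} (hsymm : ∀ v w, g v w = g w v)
    (hpos : ∀ v, v ≠ 0 → 0 < g v v) {Λ : 𝔭 →ₗ[ℝ] 𝔭 →ₗ[ℝ] 𝔭} (hΛ : IsLeviCivita g Λ)
    {Y : 𝔭} (hY : (Y : 𝔤) ∈ p₁) {γ : ℝ}
    (hγ : casimir (l ⊔ (p₁ ⊔ p₂)) (Y : 𝔤) = γ • (Y : 𝔤)) :
    ricci Λ Y Y = γ / 2 * B (Y : 𝔤) Y := by
  have hl : IsOrth 𝔭 l := by rw [h𝔭]; exact (hs.orth_l_p₁.sup_right hs.orth_l_p₂).symm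
  have hbr : ∀ X Z : 𝔭, ⁅(X : 𝔤), (Z : 𝔤)⁆ ∈ l := by
    rintro ⟨X, hX⟩ ⟨Z, hZ⟩
    rw [h𝔭] at hX hZ
    obtain ⟨X₁, hX₁, X₂, hX₂, rfl⟩ := Submodule.mem_sup.1 hX
    obtain ⟨Z₁, hZ₁, Z₂, hZ₂, rfl⟩ := Submodule.mem_sup.1 hZ
    simp only [add_lie, lie_add, hs.lie_p₁_p₂ _ hX₁ _ hZ₂, hs.swap.lie_p₁_p₂ _ hX₂ _ hZ₁, add_zero,
      zero_add]
    exact l.add_mem (hs.lie_p₁_p₁ _ hX₁ _ hZ₁) (hs.lie_p₂_p₂ _ hX₂ _ hZ₂)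
  have hT : ∀ X Z : 𝔭, orthProj 𝔭 ⁅(X : 𝔤), (Z : 𝔤)⁆ = 0 := fun X Z =>
    Subtype.ext (hl.proj_eq_zero (hbr X Z))
  -- Since `[𝔭,𝔭] ⊆ 𝔩`, every Koszul term vanishes: the Levi-Civita connection is the canonical one,
  -- and the curvature does not depend on `g`.
  have h0 : ∀ X Z : 𝔭, Λ X Z = 0 := by
    intro X Z
    by_contra hne
    have h1 := hΛ.koszul hsymm X Z (Λ X Z)
    simp only [hT, map_zero, LinearMap.zero_apply] at h1
    linarith [hpos _ hne]
  have h2 : ∀ X : 𝔭, orthProj 𝔭 ((-(ad ℝ 𝔤 (Y : 𝔤) * ad ℝ 𝔤 (Y : 𝔤))) (X : 𝔤)) =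
      curvature Λ Y Y X := by
    intro X
    simp only [curvature, LinearMap.coe_mk, AddHom.coe_mk, h0, hT, Submodule.coe_zero, sub_zero,
      zero_sub, LinearMap.neg_apply, Module.End.mul_apply, ad_apply, map_neg]
    rw [← lie_skew (X : 𝔤) (Y : 𝔤), neg_lie, lie_skew]
  have h3 : proj 𝔭 = proj p₁ + proj p₂ := by rw [h𝔭, hs.orth_p₁_p₂.proj_sup]
  rw [ricci, ← trace_mul_proj _ _ h2, h3, neg_mul, mul_add, map_neg,
    map_add, hs.trace_p₁ hY hγ, hs.trace_p₂ hY]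
  ring

open LieAlgebra in
/-- The Casimir operator of a subspace is non-negative, and vanishes only on elements that commute
with the subspace. -/
theorem casimir_eigenvalue_pos {U : Submodule ℝ 𝔤} {Y : 𝔤} {γ : ℝ} (hγ : casimir U Y = γ • Y)
    (h : ∃ X ∈ U, ⁅X, Y⁆ ≠ 0) : 0 < γ := by
  have hY : Y ≠ 0 := by
    rintro rfl
    obtain ⟨X, _, hX⟩ := h
    exact hX (lie_zero X)
  have hc := congrArg (fun v => B v Y) hγ
  simp only [B_casimir, B_smul_left] at hc
  have hPa : ∀ X, proj U (proj U X) = proj U X := fun X => proj_of_mem (proj_mem U X)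
  have hP : proj U * proj U = proj U := LinearMap.ext hPa
  let Q : LinearMap.BilinForm ℝ 𝔤 := -killingForm ℝ 𝔤
  have hQ : ∀ u v, Q u v = B u v := fun u v => rfl
  obtain ⟨e, he⟩ := exists_orthonormal_basis Q (fun x y => B_comm x y) (fun x hx => B_pos hx)
  -- Splitting `proj U` as its own square and cycling one factor turns the trace into minus a sum of
  -- squared norms.
  have htr : LinearMap.trace ℝ 𝔤 (ad ℝ 𝔤 Y * ad ℝ 𝔤 Y * proj U) =
      -∑ i, B ⁅Y, proj U (e i)⁆ ⁅Y, proj U (e i)⁆ := by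
    rw [← hP, ← mul_assoc, LinearMap.trace_mul_comm, ← mul_assoc, ← mul_assoc,
      trace_eq_sum_form e he, ← Finset.sum_neg_distrib]
    refine Finset.sum_congr rfl fun i _ => ?_
    simp only [hQ, Module.End.mul_apply, ad_apply]
    rw [B_proj, B_lie_right]
    simp only [hPa]
  have hex : ∃ i, ⁅Y, proj U (e i)⁆ ≠ 0 := by
    by_contra! h0
    have h1 : ad ℝ 𝔤 Y * proj U = 0 := e.ext fun i => by simpa using h0 i
    obtain ⟨X, hX, hXY⟩ := h
    apply hXY
    have h2 := congrArg (fun T : Module.End ℝ 𝔤 => T X) h1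
    simp only [Module.End.mul_apply, proj_of_mem hX, ad_apply, LinearMap.zero_apply] at h2
    rw [← lie_skew, h2, neg_zero]
  obtain ⟨i, hi⟩ := hex
  have hsum : 0 < ∑ i, B ⁅Y, proj U (e i)⁆ ⁅Y, proj U (e i)⁆ :=
    Finset.sum_pos' (fun i _ => B_self_nonneg _) ⟨i, Finset.mem_univ _, B_pos hi⟩
  rw [htr, neg_neg] at hc
  exact pos_of_mul_pos_left (hc ▸ hsum) (B_self_nonneg Y)

end Algebraic

/-! ### Algebra of the Einstein equations -/

/-- The three Einstein equations, solved for the ratios `t₁`, `t₂`. -/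
theorem einstein_ratio {γ₁ γ₂ t₁ t₂ s : ℝ} (ht₁ : 0 < t₁)
    (ht₂ : 0 < t₂) (hF : γ₁ * t₂ = γ₂ * t₁)
    (h₁ : γ₁ / 2 + t₁ ^ 2 * (1 - γ₁) = 2 * t₁ * s) (h₂ : γ₂ / 2 + t₂ ^ 2 * (1 - γ₂) = 2 * t₂ * s) :
    γ₂ = γ₁ ∨ γ₂ = 1 - γ₁ := by
  have h3 : (γ₂ - γ₁) * (γ₂ - (1 - γ₁)) = 0 := by
    -- The product of the two factors is `γ₁(1 - γ₁) - γ₂(1 - γ₂)`. The combination eliminates `s`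
    -- between `h₁` and `h₂` by means of `hF`, without dividing by `γ₁` or `γ₂`.
    have h4 : t₁ * t₁ * t₂ * ((γ₂ - γ₁) * (γ₂ - (1 - γ₁))) = 0 := by
      linear_combination -γ₁ * t₁ * h₂ + γ₁ * t₂ * h₁ + (t₁ * t₂ * (1 - γ₂) - γ₁ / 2) * hF
    have h5 : t₁ * t₁ * t₂ ≠ 0 := by positivity
    exact (mul_eq_zero.1 h4).resolve_left h5
  rcases mul_eq_zero.1 h3 with h | h
  · left; linarith
  · right; linarith

/-- Completing the square: the discriminant equals `(2aX - p)²`, so it is non-negative and its root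
is `±(2aX - p)`. -/
theorem quadratic_root {a p q X : ℝ} (ha : 0 < a) (h : a * X ^ 2 - p * X + q = 0) :
    0 ≤ p ^ 2 - 4 * a * q ∧
      (X = (p + √(p ^ 2 - 4 * a * q)) / (2 * a) ∨ X = (p - √(p ^ 2 - 4 * a * q)) / (2 * a)) := by
  have h1 : p ^ 2 - 4 * a * q = (2 * a * X - p) ^ 2 := by linear_combination (-4 * a) * h
  rw [h1, Real.sqrt_sq_eq_abs]
  refine ⟨sq_nonneg _, ?_⟩
  rcases abs_choice (2 * a * X - p) with h2 | h2 <;> rw [h2]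
  · left; field_simp; ring
  · right; field_simp; ring

/-- Dividing the equation by `t²` and writing `1/t = 2X` gives `2γX² - (1 + 2c)X + (1 - γ + 2b) =
0`. -/
theorem einstein_binormal {γ t s b c X : ℝ} (hγ : 0 < γ) (ht : 0 < t)
    (hX : X = 1 / (2 * t)) (h : γ / 2 + t ^ 2 * (1 - γ) = 2 * t * s)
    (hs : s = 1 / 4 + c / 2 - t * b) :
    0 ≤ discΔ γ b c ∧ (X = (1 + 2 * c + √(discΔ γ b c)) / (4 * γ) ∨
      X = (1 + 2 * c - √(discΔ γ b c)) / (4 * γ)) := by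
  have h1 : 2 * γ * X ^ 2 - (1 + 2 * c) * X + (1 - γ + 2 * b) = 0 := by
    subst hX hs
    field_simp
    linear_combination 2 * h
  have h2 := quadratic_root (by positivity) h1
  have h3 : (1 + 2 * c) ^ 2 - 4 * (2 * γ) * (1 - γ + 2 * b) = discΔ γ b c := by
    rw [discΔ]; ring
  rw [h3, show 2 * (2 * γ) = 4 * γ by ring] at h2
  exact h2

/-- Here `t₂ = (1 - γ)t₁/γ`. Taking `γX` as the unknown makes the quadratic monic with discriminant
exactly `discD`. -/
theorem einstein_diagonal {γ t₁ t₂ s b₁ b₂ c X : ℝ} (hγ : 0 < γ) (ht : 0 < t₁)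
    (hF : γ * t₂ = (1 - γ) * t₁)
    (hX : X = 1 / (2 * t₁)) (h : γ / 2 + t₁ ^ 2 * (1 - γ) = 2 * t₁ * s)
    (hs : s = 1 / 4 + c / 2 - t₁ * b₁ - t₂ * b₂) :
    0 ≤ discD γ b₁ b₂ c ∧ (X = (2 * rConst c + √(discD γ b₁ b₂ c)) / (2 * γ) ∨
      X = (2 * rConst c - √(discD γ b₁ b₂ c)) / (2 * γ)) := by
  have ht₂ : t₂ = (1 - γ) * t₁ / γ := by field_simp; linarith
  have h1 : 1 * (γ * X) ^ 2 - (2 * rConst c) * (γ * X) +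
      (γ * (1 - γ) / 2 + b₁ * γ + b₂ * (1 - γ)) = 0 := by
    subst hX hs ht₂
    rw [rConst]
    field_simp at h ⊢
    linear_combination h / 4
  have h2 := quadratic_root one_pos h1
  have h3 : (2 * rConst c) ^ 2 - 4 * 1 * (γ * (1 - γ) / 2 + b₁ * γ + b₂ * (1 - γ)) =
      discD γ b₁ b₂ c := by
    rw [discD]; ring
  rw [h3] at h2
  refine ⟨h2.1, h2.2.imp (fun h4 => ?_) fun h4 => ?_⟩
  · field_simp
    linarith
  · field_simp
    linarith

/-! ### Symmetric operators and Schur's lemma for `Ad H`-modules -/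

/-- A symmetric operator on a Euclidean space has an eigenvector. -/
theorem exists_eigenvector_of_symmetric {V : Type*} [AddCommGroup V] [Module ℝ V]
    [FiniteDimensional ℝ V] [Nontrivial V] (Q : LinearMap.BilinForm ℝ V)
    (hs : ∀ x y, Q x y = Q y x) (hp : ∀ x, x ≠ 0 → 0 < Q x x) (T : Module.End ℝ V)
    (hT : ∀ x y, Q (T x) y = Q x (T y)) : ∃ μ : ℝ, ∃ x, x ≠ 0 ∧ T x = μ • x := by
  let core : InnerProductSpace.Core ℝ V :=
    { inner := fun x y => Q x y
      conj_inner_symm := fun x y => by simpa using hs y x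
      re_inner_nonneg := fun x => by
        by_cases h : x = 0
        · simp [h]
        · simpa using (hp x h).le
      add_left := fun x y z => by simp
      smul_left := fun x y r => by simp
      definite := fun x h => by
        by_contra hx
        exact (hp x hx).ne' h }
  let _ : NormedAddCommGroup V := core.toNormedAddCommGroup
  let _ : InnerProductSpace ℝ V := InnerProductSpace.ofCore core.toCore
  have hsym : T.IsSymmetric := fun x y => hT x y
  obtain ⟨x, hx⟩ := hsym.hasEigenvalue_iSup_of_finiteDimensional.exists_hasEigenvector
  exact ⟨_, x, hx.2, hx.apply_eq_smul⟩

section LieGroup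

variable {E : Type*} [NormedAddCommGroup E] [NormedSpace ℝ E] [FiniteDimensional ℝ E]
variable {G : Type*} [TopologicalSpace G] [ChartedSpace E G] [Group G]
variable [LieGroup 𝓘(ℝ, E) ∞ G]

instance [CompactSpace G] [LieAlgebra.IsSemisimple ℝ (LieAlg E G)] :
    IsCompactType (LieAlg E G) := ⟨killingForm_neg⟩

theorem B_Ad (a : G) (v w : LieAlg E G) : B (Ad a v) (Ad a w) = B v w := by
  simp only [B, killingForm_Ad]

theorem B_Ad_left (a : G) (v w : LieAlg E G) : B (Ad a v) w = B v (Ad a⁻¹ w) := by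
  rw [← B_Ad a v, Ad_apply_Ad_inv]

/-- `f` is an endomorphism of the `Ad H`-module `𝔤`. -/
def CommutesAd (H : Subgroup G) (f : Module.End ℝ (LieAlg E G)) : Prop :=
  ∀ a ∈ H, ∀ v, f (Ad a v) = Ad a (f v)

theorem CommutesAd.mul {H : Subgroup G} {f f' : Module.End ℝ (LieAlg E G)}
    (h : CommutesAd H f) (h' : CommutesAd H f') : CommutesAd H (f * f') := fun a ha v => by
  rw [Module.End.mul_apply, h' a ha, h a ha, Module.End.mul_apply]

variable {H : Subgroup G} {U V : Submodule ℝ (LieAlg E G)}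

theorem AdInvariant.mono {H' : Subgroup G} (h : AdInvariant H U) (hH : H' ≤ H) :
    AdInvariant H' U := fun a ha => h a (hH ha)

theorem AdInvariant.sup (hU : AdInvariant H U) (hV : AdInvariant H V) : AdInvariant H (U ⊔ V) := by
  intro a ha x hx
  obtain ⟨u, hu, v, hv, rfl⟩ := Submodule.mem_sup.1 hx
  rw [map_add]
  exact Submodule.add_mem_sup (hU a ha u hu) (hV a ha v hv)

theorem AdInvariant.inf (hU : AdInvariant H U) (hV : AdInvariant H V) : AdInvariant H (U ⊓ V) :=
  fun a ha x hx => ⟨hU a ha x hx.1, hV a ha x hx.2⟩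

theorem AdInvariant.perp (hU : AdInvariant H U) : AdInvariant H (perp U) := by
  intro a ha x hx
  rw [mem_perp] at hx ⊢
  intro u hu
  rw [B_comm, B_Ad_left, B_comm]
  exact hx _ (hU _ (H.inv_mem ha) u hu)

theorem CommutesAd.adInvariant_ker {f : Module.End ℝ (LieAlg E G)} (hf : CommutesAd H f) :
    AdInvariant H (LinearMap.ker f) := by
  intro a ha x hx
  rw [LinearMap.mem_ker] at hx ⊢
  rw [hf a ha, hx, map_zero]

theorem CommutesAd.adInvariant_map {f : Module.End ℝ (LieAlg E G)} (hf : CommutesAd H f)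
    (hU : AdInvariant H U) : AdInvariant H (U.map f) := by
  rintro a ha _ ⟨x, hx, rfl⟩
  exact ⟨Ad a x, hU a ha x hx, hf a ha x⟩

theorem CommutesAd.adEquivalent_map {f : Module.End ℝ (LieAlg E G)} (hf : CommutesAd H f)
    (hinj : ∀ u ∈ U, f u = 0 → u = 0) : AdEquivalent H U (U.map f) := by
  have hi : Function.Injective (f.domRestrict U) := by
    rw [← LinearMap.ker_eq_bot, LinearMap.ker_eq_bot']
    intro u hu
    exact Subtype.ext (hinj u u.2 hu)
  let e₀ : U ≃ₗ[ℝ] LinearMap.range (f.domRestrict U) := LinearEquiv.ofInjective _ hi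
  let e : U ≃ₗ[ℝ] U.map f := e₀.trans (LinearEquiv.ofEq _ _ (LinearMap.range_domRestrict U f))
  have he : ∀ u : U, (e u : LieAlg E G) = f u := fun u => rfl
  refine ⟨e, fun a ha u u' h => ?_⟩
  rw [he, he, ← h, hf a ha]

/-- The restriction of an invariant metric. -/
theorem IsInvariantMetric.restrict {g : LinearMap.BilinForm ℝ V} (hg : IsInvariantMetric H g)
    (hUV : U ≤ V) :
    IsInvariantMetric H (g.compl₁₂ (Submodule.inclusion hUV) (Submodule.inclusion hUV)) := by
  refine ⟨fun v w => hg.1 _ _, fun v hv => hg.2.1 _ ?_, fun a ha v w v' w' hv hw =>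
    hg.2.2 a ha _ _ _ _ hv hw⟩
  intro h
  exact hv (Submodule.inclusion_injective hUV (h.trans (map_zero _).symm))

variable [IsCompactType (LieAlg E G)]

theorem CommutesAd.proj (hU : AdInvariant H U) : CommutesAd H (proj U) := by
  intro a ha x
  refine proj_eq (hU a ha _ (proj_mem U x)) fun w hw => ?_
  rw [← map_sub, B_comm, B_Ad_left, B_comm]
  exact B_sub_proj (hU _ (H.inv_mem ha) w hw) x

/-- If `f` commutes with `Ad H` and does not vanish on `U`, then it is injective on a non-zero
submodule of `U`. -/
theorem CommutesAd.exists_injective {f : Module.End ℝ (LieAlg E G)} (hf : CommutesAd H f)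
    (hU : AdInvariant H U) (h0 : ∃ u ∈ U, f u ≠ 0) :
    ∃ W ≤ U, AdInvariant H W ∧ W ≠ ⊥ ∧ ∀ w ∈ W, f w = 0 → w = 0 := by
  -- The submodule is the `B`-complement of the kernel inside `U`: a kernel element in it is
  -- orthogonal to itself.
  refine ⟨U ⊓ HomFib.perp (U ⊓ LinearMap.ker f), inf_le_left,
    hU.inf (hU.inf hf.adInvariant_ker).perp, ?_, ?_⟩
  · intro hbot
    obtain ⟨u, hu, hfu⟩ := h0
    have hk := proj_mem (U ⊓ LinearMap.ker f) u
    have hm : u - HomFib.proj (U ⊓ LinearMap.ker f) u ∈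
        U ⊓ HomFib.perp (U ⊓ LinearMap.ker f) :=
      ⟨U.sub_mem hu hk.1, mem_perp.2 fun w hw => B_sub_proj hw u⟩
    rw [hbot, Submodule.mem_bot, sub_eq_zero] at hm
    rw [hm] at hfu
    exact hfu hk.2
  · intro w hw hfw
    exact B_self_eq_zero.1 (mem_perp.1 hw.2 w ⟨hw.1, hfw⟩)

/-- Schur's lemma for inequivalent irreducible submodules. -/
theorem CommutesAd.eq_zero_of_irreducible {f : Module.End ℝ (LieAlg E G)} (hf : CommutesAd H f)
    (hU : AdIrreducible H U) (hV : AdIrreducible H V) (hUV : ¬ AdEquivalent H U V)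
    (hmap : ∀ u ∈ U, f u ∈ V) {u : LieAlg E G} (hu : u ∈ U) : f u = 0 := by
  by_contra hne
  obtain ⟨W, hWU, hW, hW0, hinj⟩ := hf.exists_injective hU.1 ⟨u, hu, hne⟩
  obtain rfl : W = U := (hU.2.2 W hWU hW).resolve_left hW0
  have hle : W.map f ≤ V := by
    rintro _ ⟨x, hx, rfl⟩
    exact hmap x hx
  have hV' : W.map f = V := by
    refine (hV.2.2 _ hle (hf.adInvariant_map hW)).resolve_left fun hbot => hne ?_
    have := Submodule.mem_map_of_mem (f := f) hu
    rwa [hbot, Submodule.mem_bot] at this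
  exact hUV (hV' ▸ hf.adEquivalent_map hinj)

/-- A symmetric endomorphism of an irreducible submodule is a scalar. -/
theorem CommutesAd.eq_smul_of_irreducible {f : Module.End ℝ (LieAlg E G)} (hf : CommutesAd H f)
    (hU : AdIrreducible H U) (hmap : ∀ u ∈ U, f u ∈ U)
    (hsymm : ∀ u ∈ U, ∀ v ∈ U, B (f u) v = B u (f v)) : ∃ x : ℝ, ∀ u ∈ U, f u = x • u := by
  have hnt : Nontrivial U := Submodule.nontrivial_iff_ne_bot.2 hU.2.1
  -- Over `ℝ`, irreducibility alone gives only a division algebra of endomorphisms; symmetry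
  -- supplies a real eigenvalue. Its eigenspace is then an invariant non-zero submodule.
  obtain ⟨x, u, hu, hx⟩ := exists_eigenvector_of_symmetric
    ((-killingForm ℝ (LieAlg E G)).compl₁₂ U.subtype U.subtype)
    (fun x y => B_comm (x : LieAlg E G) y) (fun x hx => B_pos (by simpa using hx))
    (f.restrict hmap) (fun v w => hsymm v v.2 w w.2)
  refine ⟨x, ?_⟩
  have hcomm : CommutesAd H (f - x • (1 : Module.End ℝ (LieAlg E G))) := by
    intro a ha v
    simp [hf a ha]
  have hk : ∀ v, v ∈ LinearMap.ker (f - x • (1 : Module.End ℝ (LieAlg E G))) ↔ f v = x • v := by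
    intro v
    simp [sub_eq_zero]
  rcases hU.2.2 _ inf_le_left (hU.1.inf hcomm.adInvariant_ker) with h | h
  · have hmem : (u : LieAlg E G) ∈
        U ⊓ LinearMap.ker (f - x • (1 : Module.End ℝ (LieAlg E G))) :=
      ⟨u.2, (hk _).2 (congrArg Subtype.val hx)⟩
    rw [h, Submodule.mem_bot] at hmem
    exact absurd (Subtype.ext hmem) hu
  · intro v hv
    rw [← h] at hv
    exact (hk v).1 hv.2

/-- The operator that represents an invariant metric with respect to `B`. -/
theorem IsInvariantMetric.exists_operator {g : LinearMap.BilinForm ℝ U} (hg : IsInvariantMetric H g)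
    (hU : AdInvariant H U) : ∃ A : Module.End ℝ (LieAlg E G),
      (∀ v w, B (A v) w = g (orthProj U v) (orthProj U w)) ∧ CommutesAd H A := by
  let Q : LinearMap.BilinForm ℝ (LieAlg E G) := -killingForm ℝ (LieAlg E G)
  have hQ : Q.Nondegenerate :=
    ⟨fun x hx => B_self_eq_zero.1 (hx x), fun x hx => B_self_eq_zero.1 (hx x)⟩
  let A := LinearMap.BilinForm.symmCompOfNondegenerate
    (g.compl₁₂ (orthProj U) (orthProj U) : LinearMap.BilinForm ℝ (LieAlg E G)) Q hQ
  have hA : ∀ v w, B (A v) w = g (orthProj U v) (orthProj U w) := fun v w =>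
    LinearMap.BilinForm.symmCompOfNondegenerate_left_apply _ hQ w v
  refine ⟨A, hA, fun a ha v => ?_⟩
  refine eq_of_B_eq (U := ⊤) trivial trivial fun w _ => ?_
  rw [hA, B_Ad_left, hA]
  have hp := CommutesAd.proj hU
  refine hg.2.2 a ha _ _ _ _ (hp a ha v).symm ?_
  rw [coe_orthProj, coe_orthProj, hp _ (H.inv_mem ha), Ad_apply_Ad_inv]

/-- An invariant metric on an irreducible submodule is a multiple of `B`. -/
theorem IsInvariantMetric.eq_smul_of_irreducible {g : LinearMap.BilinForm ℝ U}
    (hg : IsInvariantMetric H g) (hU : AdIrreducible H U) :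
    ∃ x : ℝ, 0 < x ∧ ∀ v w : U, g v w = x * B (v : LieAlg E G) w := by
  obtain ⟨A, hA, hc⟩ := hg.exists_operator hU.1
  have hp : ∀ v : U, orthProj U (v : LieAlg E G) = v := fun v => Subtype.ext (proj_of_mem v.2)
  have hA' : ∀ v w : U, B (proj U (A v)) (w : LieAlg E G) = g v w := fun v w => by
    rw [B_proj_left w.2, hA, hp, hp]
  obtain ⟨x, hx⟩ := ((CommutesAd.proj hU.1).mul hc).eq_smul_of_irreducible hU
    (fun u _ => proj_mem U _) (fun u hu v hv => by
      rw [Module.End.mul_apply, Module.End.mul_apply, hA' ⟨u, hu⟩ ⟨v, hv⟩, hg.1,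
        ← hA' ⟨v, hv⟩ ⟨u, hu⟩, B_comm])
  have hgx : ∀ v w : U, g v w = x * B (v : LieAlg E G) w := fun v w => by
    rw [← hA', ← Module.End.mul_apply, hx v v.2, B_smul_left]
  refine ⟨x, ?_, hgx⟩
  obtain ⟨v, hv, hv0⟩ := Submodule.exists_mem_ne_zero_of_ne_bot hU.2.1
  have h1 := hg.2.1 ⟨v, hv⟩ (by simpa using hv0)
  rw [hgx] at h1
  exact pos_of_mul_pos_left h1 (B_self_nonneg v)

end LieGroup

/-! ### The splitting of a symmetric fibration; adapted metrics are diagonal -/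

section LieGroup

variable {E : Type*} [NormedAddCommGroup E] [NormedSpace ℝ E] [FiniteDimensional ℝ E]
variable {G : Type*} [TopologicalSpace G] [ChartedSpace E G] [Group G]
variable [LieGroup 𝓘(ℝ, E) ∞ G]
variable {K L : Subgroup G} {p₁ p₂ : Submodule ℝ (LieAlg E G)}

theorem lieSub_mono (h : L ≤ K) : lieSub (E := E) L ≤ lieSub K := by
  refine Submodule.span_mono ?_
  rintro v ⟨γ, h1, h2, h3, h4⟩
  exact ⟨γ, h1, h2, fun t => h (h3 t), h4⟩

namespace IsSymmetricFibration

theorem lieSub_le (h : IsSymmetricFibration K L p₁ p₂) : lieSub (E := E) L ≤ lieSub K :=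
  lieSub_mono h.L_lt_K.le

theorem pSpace_le (h : IsSymmetricFibration K L p₁ p₂) : p₁ ⊔ p₂ ≤ lieSub K := by
  rw [h.sup_eq]; exact inf_le_left

theorem adInvariant_n (h : IsSymmetricFibration K L p₁ p₂) :
    AdInvariant L (nSpace (E := E) K) := h.base_irreducible.1.mono h.L_lt_K.le

theorem adInvariant_p (h : IsSymmetricFibration K L p₁ p₂) : AdInvariant L (p₁ ⊔ p₂) :=
  h.irreducible₁.1.sup h.irreducible₂.1

theorem orth_l_p (h : IsSymmetricFibration K L p₁ p₂) : IsOrth (lieSub L) (p₁ ⊔ p₂) := by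
  rw [h.sup_eq]
  exact fun u hu v hv => mem_perp.1 hv.2 u hu

theorem orth_k_n (K : Subgroup G) : IsOrth (lieSub K) (nSpace (E := E) K) :=
  fun u hu _ hv => mem_perp.1 hv u hu

theorem orth_p_n (h : IsSymmetricFibration K L p₁ p₂) : IsOrth (p₁ ⊔ p₂) (nSpace K) :=
  fun u hu v hv => orth_k_n K u (h.pSpace_le hu) v hv

variable [IsCompactType (LieAlg E G)]

/-- Only disjointness is assumed. The `B`-projection from `𝔭₁` to `𝔭₂` commutes with `Ad L`, so
inequivalence forces it to vanish. -/
theorem orth_p₁_p₂ (h : IsSymmetricFibration K L p₁ p₂) : IsOrth p₁ p₂ := by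
  intro u hu v hv
  rw [← B_proj_left hv, (CommutesAd.proj h.irreducible₂.1).eq_zero_of_irreducible h.irreducible₁
    h.irreducible₂ h.inequivalent (fun u _ => proj_mem p₂ u) hu, B_zero_left]

theorem lieSub_eq_sup (h : IsSymmetricFibration K L p₁ p₂) :
    lieSub K = lieSub L ⊔ (p₁ ⊔ p₂) := by
  refine le_antisymm (fun x hx => ?_) (sup_le h.lieSub_le h.pSpace_le)
  rw [h.sup_eq, ← add_sub_cancel (proj (lieSub L) x) x]
  refine Submodule.add_mem_sup (proj_mem _ x)
    ⟨Submodule.sub_mem _ hx (h.lieSub_le (proj_mem _ x)), ?_⟩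
  exact mem_perp.2 fun w hw => B_sub_proj hw x

theorem mSpace_eq_sup (h : IsSymmetricFibration K L p₁ p₂) :
    mSpace L = p₁ ⊔ p₂ ⊔ nSpace K := by
  have hn : nSpace (E := E) K ≤ mSpace L := fun x hx =>
    mem_perp.2 fun u hu => orth_k_n K u (h.lieSub_le hu) x hx
  refine le_antisymm (fun x hx => ?_) (sup_le ?_ hn)
  · have h1 : x - proj (lieSub K) x ∈ nSpace (E := E) K :=
      mem_perp.2 fun w hw => B_sub_proj hw x
    rw [← add_sub_cancel (proj (lieSub K) x) x]
    refine Submodule.add_mem_sup ?_ h1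
    rw [h.sup_eq]
    refine ⟨proj_mem _ x, ?_⟩
    rw [← sub_sub_cancel x (proj (lieSub K) x)]
    exact Submodule.sub_mem _ hx (hn h1)
  · rw [h.sup_eq]; exact inf_le_right

theorem splitting (h : IsSymmetricFibration K L p₁ p₂) :
    IsSplitting (lieSub L) p₁ p₂ (nSpace K) where
  orth_l_p₁ := fun u hu v hv => h.orth_l_p u hu v (Submodule.mem_sup_left hv)
  orth_l_p₂ := fun u hu v hv => h.orth_l_p u hu v (Submodule.mem_sup_right hv)
  orth_l_n := fun u hu v hv => orth_k_n K u (h.lieSub_le hu) v hv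
  orth_p₁_p₂ := h.orth_p₁_p₂
  orth_p₁_n := fun u hu v hv => h.orth_p_n u (Submodule.mem_sup_left hu) v hv
  orth_p₂_n := fun u hu v hv => h.orth_p_n u (Submodule.mem_sup_right hu) v hv
  sup_eq_top := by
    rw [← h.mSpace_eq_sup]
    exact (isCompl_perp _).sup_eq_top
  lie_p₁_p₁ := fun x hx y hy => h.fiber_symmetric x (h.sup_eq ▸ Submodule.mem_sup_left hx) y
    (h.sup_eq ▸ Submodule.mem_sup_left hy)
  lie_p₂_p₂ := fun x hx y hy => h.fiber_symmetric x (h.sup_eq ▸ Submodule.mem_sup_right hx) y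
    (h.sup_eq ▸ Submodule.mem_sup_right hy)
  lie_p₁_p₂ := fun x hx y hy => by
    have h1 := h.fiber_symmetric x (h.sup_eq ▸ Submodule.mem_sup_left hx) y
      (h.sup_eq ▸ Submodule.mem_sup_right hy)
    -- `[x,y]` lies in `𝔩` and is orthogonal to `𝔩`: `B([x,y],w) = B(x,[y,w])` with `[y,w] ∈ 𝔭₂ ⊥
    -- 𝔭₁`.
    refine eq_of_B_eq h1 (Submodule.zero_mem _) fun w hw => ?_
    rw [B_zero_left, B_lie_left, ← lie_skew, B_neg_right,
      h.orth_p₁_p₂ x hx _ (h.irreducible₂.1.lie_mem hw hy), neg_zero]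
  lie_l_p₁ := fun _ hx _ hy => h.irreducible₁.1.lie_mem hx hy
  lie_l_p₂ := fun _ hx _ hy => h.irreducible₂.1.lie_mem hx hy
  lie_l_n := fun _ hx _ hy => h.adInvariant_n.lie_mem hx hy
  lie_p₁_n := fun _ hx _ hy =>
    h.base_irreducible.1.lie_mem (h.pSpace_le (Submodule.mem_sup_left hx)) hy
  lie_p₂_n := fun _ hx _ hy =>
    h.base_irreducible.1.lie_mem (h.pSpace_le (Submodule.mem_sup_right hx)) hy

theorem adInvariant_m (h : IsSymmetricFibration K L p₁ p₂) : AdInvariant L (mSpace (E := E) L) := by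
  rw [h.mSpace_eq_sup]
  exact h.adInvariant_p.sup h.adInvariant_n

/-- An adapted metric is diagonal. -/
theorem isDiagMetric (h : IsSymmetricFibration K L p₁ p₂)
    {g : LinearMap.BilinForm ℝ (mSpace (E := E) L)} (hg : IsAdapted K g) :
    ∃ x₁ x₂ y : ℝ, 0 < x₁ ∧ 0 < x₂ ∧ 0 < y ∧ IsDiagMetric p₁ p₂ (nSpace K) x₁ x₂ y g := by
  obtain ⟨hinv, ⟨gN, hgN, hsub⟩, -⟩ := hg
  have hs := h.splitting
  have hm := h.mSpace_eq_sup
  have hp₁ : p₁ ≤ mSpace L := hm ▸ le_sup_left.trans le_sup_left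
  have hp₂ : p₂ ≤ mSpace L := hm ▸ le_sup_right.trans le_sup_left
  have hn : nSpace K ≤ mSpace L := hm ▸ le_sup_right
  obtain ⟨A, hA, hcomm⟩ := hinv.exists_operator h.adInvariant_m
  have hπ : ∀ v : mSpace (E := E) L, orthProj (mSpace L) (v : LieAlg E G) = v := fun v =>
    Subtype.ext (proj_of_mem v.2)
  have hA' : ∀ v w : mSpace (E := E) L, g v w = B (A v) (w : LieAlg E G) := fun v w => by
    rw [hA, hπ, hπ]
  have h12 : ∀ v w : mSpace (E := E) L, (v : LieAlg E G) ∈ p₁ → (w : LieAlg E G) ∈ p₂ →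
      g v w = 0 := by
    intro v w hv hw
    rw [hA', ← B_proj_left hw, ← Module.End.mul_apply,
      ((CommutesAd.proj h.irreducible₂.1).mul hcomm).eq_zero_of_irreducible h.irreducible₁
        h.irreducible₂ h.inequivalent (fun u _ => proj_mem p₂ _) hv, B_zero_left]
  have hpn : ∀ v w : mSpace (E := E) L, (v : LieAlg E G) ∈ p₁ ⊔ p₂ →
      (w : LieAlg E G) ∈ nSpace K → g v w = 0 := by
    intro v w hv hw
    rw [hA', ← B_proj_left hw, ← Module.End.mul_apply]
    have hc := (CommutesAd.proj h.adInvariant_n).mul hcomm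
    by_contra hne
    -- A non-zero pairing would make some submodule `W` of `𝔭` equivalent to its image in `𝔫`.
    obtain ⟨W, hW, hWinv, hW0, hinj⟩ := hc.exists_injective h.adInvariant_p
      ⟨v, hv, fun h0 => hne (by rw [h0, B_zero_left])⟩
    refine h.inequivalent_base W _ (h.sup_eq ▸ hW) ?_ hWinv (hc.adInvariant_map hWinv) hW0
      (hc.adEquivalent_map hinj)
    rintro _ ⟨x, -, rfl⟩
    exact proj_mem _ _
  obtain ⟨x₁, hx₁, hg₁⟩ := (hinv.restrict hp₁).eq_smul_of_irreducible h.irreducible₁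
  obtain ⟨x₂, hx₂, hg₂⟩ := (hinv.restrict hp₂).eq_smul_of_irreducible h.irreducible₂
  -- `𝔫` is irreducible only under `Ad K`, so Schur's lemma is applied to the metric `gN` of the
  -- base rather than to `g`.
  obtain ⟨y, hy, hg₃⟩ := hgN.eq_smul_of_irreducible h.base_irreducible
  refine ⟨x₁, x₂, y, hx₁, hx₂, hy, fun v w => ?_⟩
  have hgn : ∀ v w : mSpace (E := E) L, (v : LieAlg E G) ∈ nSpace K →
      (w : LieAlg E G) ∈ nSpace K → g v w = y * B (v : LieAlg E G) w := by
    intro v w hv hw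
    -- By `hpn` the vectors of `𝔫` are horizontal, so the submersion condition applies to them.
    rw [hsub v w fun x hx => ⟨hpn x v (h.sup_eq ▸ hx) hv, hpn x w (h.sup_eq ▸ hx) hw⟩, hg₃,
      coe_orthProj, coe_orthProj, proj_of_mem hv, proj_of_mem hw]
  have hdec : ∀ v : mSpace (E := E) L, ∃ a b c : mSpace (E := E) L, (a : LieAlg E G) ∈ p₁ ∧
      (b : LieAlg E G) ∈ p₂ ∧ (c : LieAlg E G) ∈ nSpace K ∧ v = a + b + c := by
    intro v
    refine ⟨⟨_, hp₁ (proj_mem p₁ (v : LieAlg E G))⟩, ⟨_, hp₂ (proj_mem p₂ (v : LieAlg E G))⟩,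
      ⟨_, hn (proj_mem (nSpace K) (v : LieAlg E G))⟩,
      proj_mem _ _, proj_mem _ _, proj_mem _ _, Subtype.ext ?_⟩
    have h1 : proj (p₁ ⊔ p₂ ⊔ nSpace K) (v : LieAlg E G) = v := proj_of_mem (hm.le v.2)
    rw [hs.proj_m] at h1
    exact h1.symm
  obtain ⟨a, b, c, ha, hb, hc, rfl⟩ := hdec v
  obtain ⟨a', b', c', ha', hb', hc', rfl⟩ := hdec w
  have e1 : g a a' = x₁ * B (a : LieAlg E G) a' := hg₁ ⟨a, ha⟩ ⟨a', ha'⟩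
  have e2 : g b b' = x₂ * B (b : LieAlg E G) b' := hg₂ ⟨b, hb⟩ ⟨b', hb'⟩
  simp only [Submodule.coe_add, map_add, LinearMap.add_apply, B_add_left, B_add_right,
    hs.diagOp_p₁ _ _ _ ha, hs.diagOp_p₂ _ _ _ hb, hs.diagOp_n _ _ _ hc, B_smul_left]
  rw [e1, e2, hgn c c' hc hc', h12 a b' ha hb', hinv.1 b a', h12 a' b ha' hb,
    hpn a c' (Submodule.mem_sup_left ha) hc', hpn b c' (Submodule.mem_sup_right hb) hc',
    hinv.1 c a', hinv.1 c b', hpn a' c (Submodule.mem_sup_left ha') hc,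
    hpn b' c (Submodule.mem_sup_right hb') hc, hs.orth_p₁_p₂ _ ha _ hb',
    hs.orth_p₁_p₂.symm _ hb _ ha', hs.orth_p₁_n _ ha _ hc', hs.orth_p₂_n _ hb _ hc',
    hs.orth_p₁_n.symm _ hc _ ha', hs.orth_p₂_n.symm _ hc _ hb']
  ring

end IsSymmetricFibration

end LieGroup

/-! ### From Ricci tensors to scalar equations -/

section Algebraic

variable {𝔤 : Type*} [LieRing 𝔤] [LieAlgebra ℝ 𝔤] [IsCompactType 𝔤] [FiniteDimensional ℝ 𝔤]

/-- The quadratic form of a Casimir operator is a trace against the projection, and orthogonal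
projections add. -/
theorem IsOrth.casimir_sup_eigenvalue {U V : Submodule ℝ 𝔤} (h : IsOrth U V) {Y : 𝔤} (hY : Y ≠ 0)
    {b b₁ b₂ : ℝ} (hb : casimir (U ⊔ V) Y = b • Y) (hb₁ : casimir U Y = b₁ • Y)
    (hb₂ : casimir V Y = b₂ • Y) : b = b₁ + b₂ := by
  have e := B_casimir (U ⊔ V) Y
  have e₁ := B_casimir U Y
  have e₂ := B_casimir V Y
  rw [hb, B_smul_left, h.proj_sup, mul_add, map_add] at e
  rw [hb₁, B_smul_left] at e₁
  rw [hb₂, B_smul_left] at e₂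
  refine mul_right_cancel₀ (B_pos hY).ne' ?_
  linarith

/-- An Einstein metric on the symmetric fiber is given by the Casimir eigenvalues. -/
theorem IsSplitting.einstein_fiber {l p₁ p₂ n 𝔭 : Submodule ℝ 𝔤} (hs : IsSplitting l p₁ p₂ n)
    (h𝔭 : 𝔭 = p₁ ⊔ p₂) {g : LinearMap.BilinForm ℝ 𝔭} (hsymm : ∀ v w, g v w = g w v)
    (hpos : ∀ v, v ≠ 0 → 0 < g v v) {x₁ x₂ y : ℝ} (hg : IsDiagMetric p₁ p₂ n x₁ x₂ y g)
    {Λ : 𝔭 →ₗ[ℝ] 𝔭 →ₗ[ℝ] 𝔭} (hΛ : IsLeviCivita g Λ) {ε γ : ℝ}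
    (hE : ∀ Y Z, ricci Λ Y Z = ε * g Y Z) {Y : 𝔤} (hY : Y ∈ p₁) (hY0 : Y ≠ 0)
    (hγ : casimir (l ⊔ (p₁ ⊔ p₂)) Y = γ • Y) : γ / 2 = ε * x₁ := by
  refine mul_right_cancel₀ (B_pos hY0).ne' ?_
  have hp₁ : p₁ ≤ 𝔭 := h𝔭 ▸ le_sup_left
  rw [← hs.ricci_fiber (Y := ⟨Y, hp₁ hY⟩) h𝔭 hsymm hpos hΛ hY hγ, hE, hg,
    hs.diagOp_p₁ _ _ _ hY, B_smul_left, mul_assoc]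

theorem IsDiagLeviCivita.einstein_p₁ {l p₁ p₂ n 𝔪 : Submodule ℝ 𝔤} {x₁ x₂ y : ℝ}
    {g : LinearMap.BilinForm ℝ 𝔪} {Λ : 𝔪 →ₗ[ℝ] 𝔪 →ₗ[ℝ] 𝔪}
    (h : IsDiagLeviCivita l p₁ p₂ n x₁ x₂ y g Λ) {ε γ : ℝ} (hE : ∀ Y Z, ricci Λ Y Z = ε * g Y Z)
    {Y : 𝔤} (hY : Y ∈ p₁) (hY0 : Y ≠ 0) (hγ : casimir (l ⊔ (p₁ ⊔ p₂)) Y = γ • Y) :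
    γ / 2 + (x₁ / (2 * y)) ^ 2 * (1 - γ) = ε * x₁ := by
  refine mul_right_cancel₀ (B_pos hY0).ne' ?_
  rw [← h.ricci_p₁ (Y := ⟨Y, h.p₁_le hY⟩) hY hγ, hE, h.diag, h.splitting.diagOp_p₁ _ _ _ hY,
    B_smul_left, mul_assoc]

theorem IsDiagLeviCivita.einstein_n {l p₁ p₂ n 𝔪 : Submodule ℝ 𝔤} {x₁ x₂ y : ℝ}
    {g : LinearMap.BilinForm ℝ 𝔪} {Λ : 𝔪 →ₗ[ℝ] 𝔪 →ₗ[ℝ] 𝔪}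
    (h : IsDiagLeviCivita l p₁ p₂ n x₁ x₂ y g Λ) {ε c b₁ b₂ : ℝ}
    (hE : ∀ Y Z, ricci Λ Y Z = ε * g Y Z) {Y : 𝔤} (hY : Y ∈ n) (hY0 : Y ≠ 0)
    (hc : casimir (l ⊔ (p₁ ⊔ p₂)) Y = c • Y) (hb₁ : casimir p₁ Y = b₁ • Y)
    (hb₂ : casimir p₂ Y = b₂ • Y) :
    1 / 4 + c / 2 - x₁ / (2 * y) * b₁ - x₂ / (2 * y) * b₂ = ε * y := by
  refine mul_right_cancel₀ (B_pos hY0).ne' ?_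
  rw [← h.ricci_n (Y := ⟨Y, h.n_le hY⟩) hY hc hb₁ hb₂, hE, h.diag, h.splitting.diagOp_n _ _ _ hY,
    B_smul_left, mul_assoc]

end Algebraic

section LieGroup

variable {E : Type*} [NormedAddCommGroup E] [NormedSpace ℝ E] [FiniteDimensional ℝ E]
variable {G : Type*} [TopologicalSpace G] [ChartedSpace E G] [Group G]
variable [LieGroup 𝓘(ℝ, E) ∞ G] [IsCompactType (LieAlg E G)]
variable {K L : Subgroup G} {p₁ p₂ : Submodule ℝ (LieAlg E G)}
variable {g : LinearMap.BilinForm ℝ (mSpace (E := E) L)} {x₁ x₂ y : ℝ}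

theorem BPart_eq (U : Submodule ℝ (LieAlg E G)) (v w : LieAlg E G) :
    BPart U v w = B (proj U v) w := by
  rw [BPart, coe_orthProj, coe_orthProj, B_comm, B_proj_left (proj_mem U v), B_comm]

theorem IsDiagMetric.eq_BPart (h : IsDiagMetric p₁ p₂ (nSpace K) x₁ x₂ y g)
    (v w : mSpace (E := E) L) : g v w = x₁ * BPart p₁ (v : LieAlg E G) w +
      x₂ * BPart p₂ (v : LieAlg E G) w + y * BPart (nSpace K) (v : LieAlg E G) w := by
  rw [h v w, BPart_eq, BPart_eq, BPart_eq]
  simp [diagOp]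

theorem IsSymmetricFibration.isBinormal (hfib : IsSymmetricFibration K L p₁ p₂)
    (h : IsDiagMetric p₁ p₂ (nSpace K) x₁ x₁ y g) (hx : 0 < x₁) :
    IsBinormalUpToHomothety K g (y / x₁) := by
  refine ⟨x₁, hx, fun v w => ?_⟩
  rw [h.eq_BPart, BPart_eq (pSpace K L), ← hfib.sup_eq, hfib.orth_p₁_p₂.proj_sup,
    LinearMap.add_apply, B_add_left, ← BPart_eq, ← BPart_eq]
  field_simp

theorem IsDiagMetric.isDiagonal (h : IsDiagMetric p₁ p₂ (nSpace K) x₁ x₂ y g)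
    (hy : 0 < y) :
    IsDiagonalUpToHomothety K p₁ p₂ g (y / x₁) (y / x₂) := by
  refine ⟨y, hy, fun v w => ?_⟩
  rw [h.eq_BPart]
  field_simp

/-- The Einstein equations of an adapted metric with Einstein restriction to the fiber. -/
theorem IsSymmetricFibration.einstein_equations (hfib : IsSymmetricFibration K L p₁ p₂)
    (hadapted : IsAdapted K g) (heinstein : IsEinstein g) (hfiber : IsEinstein (fiberMetric K g))
    {γ₁ γ₂ c b₁ b₂ : ℝ} (hγ₁ : ∀ X ∈ p₁, casimir (lieSub K) X = γ₁ • X)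
    (hγ₂ : ∀ X ∈ p₂, casimir (lieSub K) X = γ₂ • X)
    (hc : ∀ X ∈ nSpace (E := E) K, casimir (lieSub K) X = c • X)
    (hb₁ : ∀ X ∈ nSpace (E := E) K, casimir p₁ X = b₁ • X)
    (hb₂ : ∀ X ∈ nSpace (E := E) K, casimir p₂ X = b₂ • X) :
    ∃ x₁ x₂ y ε : ℝ, 0 < x₁ ∧ 0 < x₂ ∧ 0 < y ∧ IsDiagMetric p₁ p₂ (nSpace K) x₁ x₂ y g ∧
      γ₁ * x₂ = γ₂ * x₁ ∧
      γ₁ / 2 + (x₁ / (2 * y)) ^ 2 * (1 - γ₁) = ε * x₁ ∧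
      γ₂ / 2 + (x₂ / (2 * y)) ^ 2 * (1 - γ₂) = ε * x₂ ∧
      1 / 4 + c / 2 - x₁ / (2 * y) * b₁ - x₂ / (2 * y) * b₂ = ε * y := by
  obtain ⟨x₁, x₂, y, hx₁, hx₂, hy, hdiag⟩ := hfib.isDiagMetric hadapted
  obtain ⟨Λ, hΛ, ε, hε⟩ := heinstein
  obtain ⟨ΛF, hΛF, εF, hεF⟩ := hfiber
  have hs := hfib.splitting
  have hD : IsDiagLeviCivita (lieSub L) p₁ p₂ (nSpace K) x₁ x₂ y g Λ :=
    ⟨hs, hfib.mSpace_eq_sup, hdiag, hadapted.1.2.1, hΛ, hy⟩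
  have hp : pSpace K L = p₁ ⊔ p₂ := hfib.sup_eq.symm
  obtain ⟨Y₁, hY₁, hY₁0⟩ := Submodule.exists_mem_ne_zero_of_ne_bot hfib.irreducible₁.2.1
  obtain ⟨Y₂, hY₂, hY₂0⟩ := Submodule.exists_mem_ne_zero_of_ne_bot hfib.irreducible₂.2.1
  obtain ⟨Y₃, hY₃, hY₃0⟩ := Submodule.exists_mem_ne_zero_of_ne_bot hfib.base_irreducible.2.1
  have hγ₁' := hγ₁ Y₁ hY₁
  have hγ₂' := hγ₂ Y₂ hY₂
  have hc' := hc Y₃ hY₃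
  rw [hfib.lieSub_eq_sup] at hγ₁' hγ₂' hc'
  rw [sup_comm p₁] at hγ₂'
  have hFm : IsInvariantMetric L (fiberMetric K g) := hadapted.1.restrict inf_le_right
  have hFd : IsDiagMetric p₁ p₂ (nSpace K) x₁ x₂ y (fiberMetric K g) := fun v w => hdiag _ _
  have hF₁ := hs.einstein_fiber hp hFm.1 hFm.2.1 hFd hΛF hεF hY₁ hY₁0 hγ₁'
  have hF₂ := hs.swap.einstein_fiber (hp.trans (sup_comm _ _)) hFm.1 hFm.2.1 hFd.swap hΛF hεF hY₂
    hY₂0 hγ₂'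
  -- The relation `γ₁ x₂ = γ₂ x₁` comes from `γₐ/2 = εF xₐ` by eliminating the Einstein constant of
  -- the fiber.
  exact ⟨x₁, x₂, y, ε, hx₁, hx₂, hy, hdiag, by linear_combination 2 * x₂ * hF₁ - 2 * x₁ * hF₂,
    hD.einstein_p₁ hε hY₁ hY₁0 hγ₁', hD.swap.einstein_p₁ hε hY₂ hY₂0 hγ₂',
    hD.einstein_n hε hY₃ hY₃0 hc' (hb₁ Y₃ hY₃) (hb₂ Y₃ hY₃)⟩

end LieGroup

end HomFib

end

theorem corollary2p8
    {E : Type*} [NormedAddCommGroup E] [NormedSpace ℝ E] [FiniteDimensional ℝ E]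
    {G : Type*} [TopologicalSpace G] [ChartedSpace E G] [Group G] [LieGroup 𝓘(ℝ, E) ∞ G]
    [T2Space G] [CompactSpace G] [ConnectedSpace G] [LieAlgebra.IsSemisimple ℝ (HomFib.LieAlg E G)]
    (K L : Subgroup G) (p₁ p₂ : Submodule ℝ (HomFib.LieAlg E G))
    (hfib : HomFib.IsSymmetricFibration K L p₁ p₂)
    (γ₁ γ₂ c b b₁ b₂ : ℝ)
    (hγ₁ : ∀ X ∈ p₁, HomFib.casimir (HomFib.lieSub K) X = γ₁ • X)
    (hγ₂ : ∀ X ∈ p₂, HomFib.casimir (HomFib.lieSub K) X = γ₂ • X)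
    (hc : ∀ X ∈ HomFib.nSpace (E := E) K, HomFib.casimir (HomFib.lieSub K) X = c • X)
    (hb₁ : ∀ X ∈ HomFib.nSpace (E := E) K, HomFib.casimir p₁ X = b₁ • X)
    (hb₂ : ∀ X ∈ HomFib.nSpace (E := E) K, HomFib.casimir p₂ X = b₂ • X)
    (hb : ∀ X ∈ HomFib.nSpace (E := E) K, HomFib.casimir (HomFib.pSpace K L) X = b • X)
    (g : LinearMap.BilinForm ℝ (HomFib.mSpace (E := E) L))
    (hadapted : HomFib.IsAdapted K g)
    (heinstein : HomFib.IsEinstein g)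
    (hfiber : HomFib.IsEinstein (HomFib.fiberMetric K g)) :
    (γ₂ = γ₁ ∨ γ₂ = 1 - γ₁) ∧
    (γ₂ = γ₁ →
      0 ≤ HomFib.discΔ γ₁ b c ∧
      ∃ X : ℝ, 0 < X ∧
        (X = (1 + 2 * c + √(HomFib.discΔ γ₁ b c)) / (4 * γ₁) ∨
          X = (1 + 2 * c - √(HomFib.discΔ γ₁ b c)) / (4 * γ₁)) ∧
        HomFib.IsBinormalUpToHomothety K g X) ∧
    (γ₂ = 1 - γ₁ →
      0 ≤ HomFib.discD γ₁ b₁ b₂ c ∧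
      ∃ X₁ X₂ : ℝ, 0 < X₁ ∧ 0 < X₂ ∧
        (X₁ = (2 * HomFib.rConst c + √(HomFib.discD γ₁ b₁ b₂ c)) / (2 * γ₁) ∨
          X₁ = (2 * HomFib.rConst c - √(HomFib.discD γ₁ b₁ b₂ c)) / (2 * γ₁)) ∧
        X₂ = γ₁ * X₁ / (1 - γ₁) ∧
        HomFib.IsDiagonalUpToHomothety K p₁ p₂ g X₁ X₂) := by
  obtain ⟨x₁, x₂, y, ε, hx₁, hx₂, hy, hdiag, hF, hE₁, hE₂, hE₃⟩ :=
    hfib.einstein_equations hadapted heinstein hfiber hγ₁ hγ₂ hc hb₁ hb₂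
  -- Absence of a flat factor makes the Casimir eigenvalues strictly positive; this allows division
  -- by `γ₁`, and by `1 - γ₁ = γ₂` in the second case.
  have hγ₁0 : 0 < γ₁ := by
    obtain ⟨X, hX, Y, hY, hne⟩ := hfib.no_flat₁
    exact HomFib.casimir_eigenvalue_pos (hγ₁ Y hY) ⟨X, hX, hne⟩
  have hγ₂0 : 0 < γ₂ := by
    obtain ⟨X, hX, Y, hY, hne⟩ := hfib.no_flat₂
    exact HomFib.casimir_eigenvalue_pos (hγ₂ Y hY) ⟨X, hX, hne⟩
  -- These ratios are invariant under homothety. The scalar `s = ε y` is what the three Einstein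
  -- equations share.
  set t₁ := x₁ / (2 * y) with ht₁
  set t₂ := x₂ / (2 * y) with ht₂
  have ht₁0 : 0 < t₁ := by positivity
  have ht₂0 : 0 < t₂ := by positivity
  have hx₁t : x₁ = 2 * y * t₁ := by rw [ht₁]; field_simp
  have hx₂t : x₂ = 2 * y * t₂ := by rw [ht₂]; field_simp
  have hX₁ : y / x₁ = 1 / (2 * t₁) := by rw [hx₁t]; field_simp
  have hX₂ : y / x₂ = 1 / (2 * t₂) := by rw [hx₂t]; field_simp
  have hF' : γ₁ * t₂ = γ₂ * t₁ := by rw [ht₁, ht₂, ← mul_div_assoc, hF, mul_div_assoc]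
  have h₁ : γ₁ / 2 + t₁ ^ 2 * (1 - γ₁) = 2 * t₁ * (ε * y) := by
    linear_combination hE₁ + ε * hx₁t
  have h₂ : γ₂ / 2 + t₂ ^ 2 * (1 - γ₂) = 2 * t₂ * (ε * y) := by
    linear_combination hE₂ + ε * hx₂t
  refine ⟨HomFib.einstein_ratio ht₁0 ht₂0 hF' h₁ h₂, fun h => ?_, fun h => ?_⟩
  · have ht : t₂ = t₁ := mul_left_cancel₀ hγ₁0.ne' (by rw [hF', h])
    have hx : x₂ = x₁ := by rw [hx₂t, ht, ← hx₁t]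
    -- A non-zero vector of `𝔫` is needed to compare the eigenvalues and obtain `b = b₁ + b₂`.
    obtain ⟨Y, hY, hY0⟩ := Submodule.exists_mem_ne_zero_of_ne_bot hfib.base_irreducible.2.1
    have hb' : b = b₁ + b₂ := hfib.orth_p₁_p₂.casimir_sup_eigenvalue hY0
      (hfib.sup_eq ▸ hb Y hY) (hb₁ Y hY) (hb₂ Y hY)
    obtain ⟨h3, h4⟩ := HomFib.einstein_binormal (b := b) hγ₁0 ht₁0 hX₁ h₁
      (by rw [← hE₃, ht, hb']; ring)
    rw [hx] at hdiag
    exact ⟨h3, _, by positivity, h4, hfib.isBinormal hdiag hx₁⟩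
  · obtain ⟨h3, h4⟩ := HomFib.einstein_diagonal hγ₁0 ht₁0 (by rw [hF', h]) hX₁ h₁ hE₃.symm
    -- The witnesses are `Xₐ = y/xₐ = 1/(2tₐ)`, the coefficients being normalized by that of `B_𝔫`.
    -- Their relation is the fiber's Einstein condition `γ₁ t₂ = γ₂ t₁`.
    refine ⟨h3, _, y / x₂, by positivity, by positivity, h4, ?_, hdiag.isDiagonal hy⟩
    rw [← h, hX₁, hX₂]
    field_simp
    linarith
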